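/- Let $\Omega=\{x\in\mathbb{R}^2:|x|<1\}$, let $\omega_0\in C_c^\infty(\Omega)$, and let $u_0=K[\omega_0]$, where $K$ is the Biot--Savart operator of the unit disk, $$K[\omega](x)=\int_\Omega \nabla_x^\perp G(x,y)\,\omega(y)\,dy,\qquad G(x,y)=\frac1{4\pi}\log\frac{|x-y|^2}{1-2x\cdot y+|x|^2|y|^2},\qquad \nabla^\perp=(-\partial_2,\partial_1).$$ For each $\nu>0$ let $u^\nu$ be the classical solution on $\Omega\times(0,\infty)$ of the Navier--Stokes equations $\partial_t u^\nu+u^\nu\cdot\nabla u^\nu=-\nabla p^\nu+\nu\Delta u^\nu$, $\operatorname{div}u^\nu=0$, with the no-slip condition $u^\nu=0$ on $\partial\Omega$ and initial velocity $u_0$; here $u^\nu$ and $p^\nu$ are smooth on $\overline\Omega\times(0,\infty)$ and $u^\nu(\cdot,t)\to u_0$ in $L^2(\Omega)$ as $t\to0^+$. Let $u$ be the solution, smooth together with its pressure on $\overline\Omega\times[0,\infty)$, of the Euler equations $\partial_t u+u\cdot\nabla u=-\nabla p$, $\operatorname{div}u=0$, with $u\cdot x=0$ for $|x|=1$ and $u(\cdot,0)=u_0$.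 Then, for every $T>0$ and every $c>0$, $$u^\nu\to u\ \text{ in } L^\infty((0,T);L^2(\Omega))\ \text{ as }\nu\to0^+$$ if and only if $$\nu\int_0^T\|\nabla u^\nu(\cdot,t)\|_{L^2(\Gamma_{c\nu})}^2\,dt\to0\ \text{ as }\nu\to0^+,$$ where $\Gamma_{c\nu}=\{x:1-c\nu<|x|<1\}$. In particular, for each $T>0$ there is a constant $c>0$ for which the equivalence holds. -/

import Mathlib

open Set Filter Topology MeasureTheory
open scoped ENNReal ContDiff

noncomputable section

namespace KatoCriterion

/-- The Euclidean plane. -/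
abbrev Plane : Type := EuclideanSpace ℝ (Fin 2)

/-- The open unit disk `Ω = {|x| < 1}`. -/
def disk : Set Plane := Metric.ball 0 1

/-- The closed unit disk. -/
def closedDisk : Set Plane := Metric.closedBall 0 1

/-- The unit circle `∂Ω = {|x| = 1}`. -/
def circle : Set Plane := Metric.sphere 0 1

/-- The boundary annulus `Γ_δ = {1 - δ < |x| < 1}`. -/
def annulus (δ : ℝ) : Set Plane := {x | 1 - δ < ‖x‖ ∧ ‖x‖ < 1}

/-- The `i`-th partial derivative of a vector field. -/
def partialDeriv (i : Fin 2) (v : Plane → Plane) (x : Plane) : Plane :=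
  fderiv ℝ v x (EuclideanSpace.single i 1)

/-- The divergence `∂₁v₁ + ∂₂v₂`. -/
def divergence (v : Plane → Plane) (x : Plane) : ℝ :=
  ∑ i, partialDeriv i v x i

/-- The squared (Frobenius) norm `|∇v|² = |∂₁v|² + |∂₂v|²` of the Jacobian matrix. -/
def gradNormSq (v : Plane → Plane) (x : Plane) : ℝ :=
  ∑ i, ‖partialDeriv i v x‖ ^ 2

/-- Rotation by a right angle, `(a, b)^⊥ = (-b, a)`. -/
def perp (v : Plane) : Plane := !₂[-v 1, v 0]

/-- The kernel of the Biot--Savart operator of the unit disk: `K(x, y) = ∇ₓ^⊥ G(x, y)`, where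
`G(x, y) = (1 / 4π) log (|x - y|² / (1 - 2 x·y + |x|²|y|²))` is the Green function of the
Dirichlet Laplacian. Note that `1 - 2 x·y + |x|²|y|² = |y|² |x - y / |y|²|²` for `y ≠ 0`. -/
def biotSavartKernel (x y : Plane) : Plane :=
  (2 * Real.pi)⁻¹ • perp ((‖x - y‖ ^ 2)⁻¹ • (x - y) -
    (1 - 2 * inner ℝ x y + ‖x‖ ^ 2 * ‖y‖ ^ 2)⁻¹ • (‖y‖ ^ 2 • x - y))

/-- The Biot--Savart operator `K[w](x) = ∫_Ω K(x, y) w(y) dy` of the unit disk. -/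
def biotSavart (w : Plane → ℝ) (x : Plane) : Plane :=
  ∫ y in disk, w y • biotSavartKernel x y

/-- The incompressible equations with viscosity `ν` at time `t` and position `x`:
`∂ₜu + u·∇u = -∇p + ν Δu` and `div u = 0`. -/
def SolvesAt (ν : ℝ) (u : ℝ → Plane → Plane) (p : ℝ → Plane → ℝ) (t : ℝ) (x : Plane) : Prop :=
  deriv (fun s => u s x) t + fderiv ℝ (u t) x (u t x)
      = -gradient (p t) x + ν • Laplacian.laplacian (u t) x ∧
    divergence (u t) x = 0

/-- `u` is a classical solution on `(0, ∞) × Ω` of the Navier--Stokes equations with viscosity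
`ν`, no-slip boundary condition and initial velocity `u₀`. Velocity and pressure are smooth up
to the boundary for positive times. Since `u₀` need not vanish on the circle, the initial
velocity is attained in the sense of `L²(Ω)`. -/
def IsNavierStokesSolution (ν : ℝ) (u₀ : Plane → Plane) (u : ℝ → Plane → Plane) : Prop :=
  ContDiffOn ℝ ∞ (fun z : ℝ × Plane => u z.1 z.2) (Ioi 0 ×ˢ closedDisk) ∧
  (∃ p : ℝ → Plane → ℝ,
    ContDiffOn ℝ ∞ (fun z : ℝ × Plane => p z.1 z.2) (Ioi 0 ×ˢ closedDisk) ∧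
    ∀ t > 0, ∀ x ∈ disk, SolvesAt ν u p t x) ∧
  (∀ t > 0, ∀ x ∈ circle, u t x = 0) ∧
  Tendsto (fun t => eLpNorm (u t - u₀) 2 (volume.restrict disk)) (𝓝[>] 0) (𝓝 0)

/-- `u` is a smooth solution on `[0, ∞) × Ω`, up to the boundary and the initial time, of the
Euler equations with the non-penetration condition `u · x = 0` on the circle and initial
velocity `u₀`. -/
def IsEulerSolution (u₀ : Plane → Plane) (u : ℝ → Plane → Plane) : Prop :=
  ContDiffOn ℝ ∞ (fun z : ℝ × Plane => u z.1 z.2) (Ici 0 ×ˢ closedDisk) ∧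
  (∃ p : ℝ → Plane → ℝ,
    ContDiffOn ℝ ∞ (fun z : ℝ × Plane => p z.1 z.2) (Ici 0 ×ˢ closedDisk) ∧
    ∀ t > 0, ∀ x ∈ disk, SolvesAt 0 u p t x) ∧
  (∀ t ≥ 0, ∀ x ∈ circle, inner ℝ (u t x) x = 0) ∧
  (∀ x ∈ closedDisk, u 0 x = u₀ x)

/-- The distance of `u` and `v` in `L^∞((0,T); L²(Ω))`. -/
def distLinftyL2 (T : ℝ) (u v : ℝ → Plane → Plane) : ℝ≥0∞ :=
  essSup (fun t => eLpNorm (u t - v t) 2 (volume.restrict disk)) (volume.restrict (Ioo 0 T))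

/-- The quantity `ν ∫₀ᵀ ‖∇u(·, t)‖²_{L²(Γ_δ)} dt`. -/
def layerDissipation (ν T δ : ℝ) (u : ℝ → Plane → Plane) : ℝ≥0∞ :=
  ENNReal.ofReal ν *
    ∫⁻ t in Ioo 0 T, ∫⁻ x in annulus δ, ENNReal.ofReal (gradNormSq (u t) x)

end KatoCriterion

end

/-!
Kato's criterion for the inviscid limit on the unit disk.

The solutions are given, so no existence theory and no property of the Biot--Savart operator is
needed: the Euler solution `u` is smooth up to the initial time, and its initial value is the common
initial velocity. Every integration by parts concerns a field without flux through the circle, so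
the divergence theorem (`integral_sum_fderiv_eq_zero`) follows from the one for compactly supported
functions by a cutoff near the circle.

*Convergence implies vanishing dissipation.* The viscous flow `w` loses exactly the energy
`2ν ∫∫ |∇w|²`, and the Euler flow keeps its energy. If `w` is close to `u` in mean square, the
energies are close, hence the whole dissipation is small (`layerDissipation_le`).

*Vanishing dissipation implies convergence.* The Euler flow violates the no-slip condition, so it
cannot be used directly as a test field for the Navier--Stokes equations. Kato's corrector `v`
repairs this: it is divergence-free, equals `u` on the circle, lives in a layer of width `δ = cν/2`,
is bounded together with `∂ₜv`, and `|∇v| ≤ K/δ` (`exists_corrector`). On the disk no stream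
function of `u` is needed: `u = (u · x^⊥) x^⊥` on the circle, and the rotated gradient of
`-½ δ κ((1 - |x|²)/δ) (u · x^⊥)` has the required boundary values whenever `κ(0) = 0` and
`κ'(0) = 1`. The relative energy `‖w‖² + ‖u‖² - 2 (w, u - v)` differs from `‖w - u‖²` by a small
quantity, and its rate (`hasDerivAt_relativeEnergy`) contains the term `-(w - u, (w - u) · ∇u)`,
which Gronwall's inequality absorbs, and terms supported in the layer. Among these
`(w, w · ∇v) ≤ (K/δ) ∫ |w|²` is the critical one: `w` vanishes on the circle, so Poincaré's
inequality in the layer (`integral_layer_norm_sq_le`) bounds it by `C δ ∫ |∇w|²` over a layer of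
width `2δ = cν`, which is the layer dissipation. The remaining terms are small by Young's inequality
with a parameter `μ` that is chosen before `ν` (`integral_sub_sq_le`).
-/

noncomputable section

namespace KatoCriterion

/-! ### Continuity up to the boundary -/

/-- The restriction of `f` to `U` extends to a continuous function on `K`. The derivatives of a
function that is smooth on the closed disk are of this kind, with `U` the open disk: on the circle
itself `fderiv` carries no information. -/
def ExtendsTo {X E : Type*} [TopologicalSpace X] [TopologicalSpace E] (K U : Set X) (f : X → E) :
    Prop :=
  ∃ g : X → E, ContinuousOn g K ∧ EqOn f g U

namespace ExtendsTo

section General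

variable {X Y E F G : Type*} [TopologicalSpace X] [TopologicalSpace Y] [TopologicalSpace E]
  [TopologicalSpace F] [TopologicalSpace G] {K U : Set X}

theorem of_continuousOn {f : X → E} (hf : ContinuousOn f K) : ExtendsTo K U f :=
  ⟨f, hf, fun _ _ => rfl⟩

theorem congr {f g : X → E} (hf : ExtendsTo K U f) (h : EqOn g f U) : ExtendsTo K U g := by
  obtain ⟨k, hk, hfk⟩ := hf
  exact ⟨k, hk, h.trans hfk⟩

theorem mono {f : X → E} {K' U' : Set X} (hf : ExtendsTo K U f) (hK : K' ⊆ K) (hU : U' ⊆ U) :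
    ExtendsTo K' U' f := by
  obtain ⟨k, hk, hfk⟩ := hf
  exact ⟨k, hk.mono hK, hfk.mono hU⟩

theorem comp {f : X → E} {φ : E → F} (hφ : Continuous φ) (hf : ExtendsTo K U f) :
    ExtendsTo K U (fun x => φ (f x)) := by
  obtain ⟨k, hk, hfk⟩ := hf
  exact ⟨fun x => φ (k x), hφ.comp_continuousOn hk, fun x hx => congrArg φ (hfk hx)⟩

theorem comp₂ {f : X → E} {g : X → F} {φ : E × F → G} (hφ : Continuous φ)
    (hf : ExtendsTo K U f) (hg : ExtendsTo K U g) :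
    ExtendsTo K U (fun x => φ (f x, g x)) := by
  obtain ⟨k, hk, hfk⟩ := hf
  obtain ⟨l, hl, hgl⟩ := hg
  exact ⟨fun x => φ (k x, l x), hφ.comp_continuousOn (hk.prodMk hl),
    fun x hx => by simp only [hfk hx, hgl hx]⟩

theorem precomp {f : X → E} (hf : ExtendsTo K U f) {φ : Y → X} (hφ : Continuous φ)
    {K' U' : Set Y} (hK : MapsTo φ K' K) (hU : MapsTo φ U' U) :
    ExtendsTo K' U' (fun y => f (φ y)) := by
  obtain ⟨k, hk, hfk⟩ := hf
  exact ⟨fun y => k (φ y), hk.comp hφ.continuousOn hK, fun y hy => hfk (hU hy)⟩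

theorem continuousOn {f : X → E} (hf : ExtendsTo K U f) (hUK : U ⊆ K) : ContinuousOn f U := by
  obtain ⟨k, hk, hfk⟩ := hf
  exact (hk.mono hUK).congr hfk

end General

section Normed

variable {X E : Type*} [TopologicalSpace X] [NormedAddCommGroup E] {K U : Set X}

theorem const (c : E) : ExtendsTo K U (fun _ => c) := of_continuousOn continuousOn_const

theorem add {f g : X → E} (hf : ExtendsTo K U f) (hg : ExtendsTo K U g) :
    ExtendsTo K U (fun x => f x + g x) := comp₂ (φ := fun p => p.1 + p.2) (by fun_prop) hf hg

theorem sub {f g : X → E} (hf : ExtendsTo K U f) (hg : ExtendsTo K U g) :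
    ExtendsTo K U (fun x => f x - g x) := comp₂ (φ := fun p => p.1 - p.2) (by fun_prop) hf hg

theorem mul {f g : X → ℝ} (hf : ExtendsTo K U f) (hg : ExtendsTo K U g) :
    ExtendsTo K U (fun x => f x * g x) := comp₂ (φ := fun p => p.1 * p.2) (by fun_prop) hf hg

theorem norm_sq {f : X → E} (hf : ExtendsTo K U f) : ExtendsTo K U (fun x => ‖f x‖ ^ 2) :=
  comp (φ := fun p => ‖p‖ ^ 2) (by fun_prop) hf

theorem clm_apply {E F : Type*} [NormedAddCommGroup E] [NormedSpace ℝ E]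
    [NormedAddCommGroup F] [NormedSpace ℝ F] {f : X → E →L[ℝ] F} {g : X → E}
    (hf : ExtendsTo K U f) (hg : ExtendsTo K U g) : ExtendsTo K U (fun x => f x (g x)) :=
  comp₂ (φ := fun p : (E →L[ℝ] F) × E => p.1 p.2)
    (continuous_fst.clm_apply continuous_snd) hf hg

theorem inner {H : Type*} [NormedAddCommGroup H] [InnerProductSpace ℝ H] {f g : X → H}
    (hf : ExtendsTo K U f) (hg : ExtendsTo K U g) :
    ExtendsTo K U (fun x => inner ℝ (f x) (g x)) :=
  comp₂ (φ := fun p : H × H => Inner.inner ℝ p.1 p.2) (by fun_prop) hf hg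

theorem sum {ι : Type*} (s : Finset ι) {f : ι → X → E} (hf : ∀ i, ExtendsTo K U (f i)) :
    ExtendsTo K U (fun x => ∑ i ∈ s, f i x) := by
  choose g hg hfg using hf
  exact ⟨fun x => ∑ i ∈ s, g i x, continuousOn_finsetSum s fun i _ => hg i,
    fun x hx => Finset.sum_congr rfl fun i _ => hfg i hx⟩

theorem exists_bound {f : X → E} (hf : ExtendsTo K U f) (hK : IsCompact K) (hUK : U ⊆ K) :
    ∃ C, 0 ≤ C ∧ ∀ x ∈ U, ‖f x‖ ≤ C := by
  obtain ⟨k, hk, hfk⟩ := hf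
  obtain ⟨C, hC⟩ := hK.exists_bound_of_continuousOn hk
  exact ⟨max C 0, le_max_right _ _,
    fun x hx => by rw [hfk hx]; exact (hC x (hUK hx)).trans (le_max_left _ _)⟩

end Normed

section Deriv

variable {X E : Type*} [NormedAddCommGroup X] [NormedSpace ℝ X] [NormedAddCommGroup E]
  [NormedSpace ℝ E] {K U : Set X}

theorem fderiv {f : X → E} (hf : ContDiffOn ℝ 1 f K) (hK : UniqueDiffOn ℝ K)
    (hU : ∀ x ∈ U, K ∈ 𝓝 x) : ExtendsTo K U (fderiv ℝ f) :=
  ⟨fderivWithin ℝ f K, hf.continuousOn_fderivWithin hK le_rfl,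
    fun x hx => (fderivWithin_of_mem_nhds (hU x hx)).symm⟩

end Deriv

end ExtendsTo

/-! ### The disk and its boundary layers -/

/-- The standard basis vectors of the plane. -/
abbrev basisVec (i : Fin 2) : Plane := EuclideanSpace.single i 1

/-- The layer `{x ∈ Ω : 1 - |x|² < δ}`. The polynomial `1 - |x|²` replaces the distance to the
circle throughout. -/
def layer (δ : ℝ) : Set Plane := {x | x ∈ disk ∧ 1 - ‖x‖ ^ 2 < δ}

theorem mem_disk {x : Plane} : x ∈ disk ↔ ‖x‖ < 1 := by simp [disk]

theorem mem_circle {x : Plane} : x ∈ circle ↔ ‖x‖ = 1 := by simp [circle]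

theorem isOpen_disk : IsOpen disk := Metric.isOpen_ball

theorem measurableSet_disk : MeasurableSet disk := isOpen_disk.measurableSet

theorem isCompact_closedDisk : IsCompact closedDisk := isCompact_closedBall _ _

theorem disk_subset : disk ⊆ closedDisk := Metric.ball_subset_closedBall

theorem circle_subset : circle ⊆ closedDisk := Metric.sphere_subset_closedBall

theorem closedDisk_mem_nhds {x : Plane} (hx : x ∈ disk) : closedDisk ∈ 𝓝 x :=
  mem_of_superset (isOpen_disk.mem_nhds hx) disk_subset

theorem uniqueDiffOn_closedDisk : UniqueDiffOn ℝ closedDisk :=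
  uniqueDiffOn_convex (convex_closedBall _ _)
    ⟨0, mem_interior_iff_mem_nhds.2 (closedDisk_mem_nhds (by simp [mem_disk]))⟩

theorem depth_pos {x : Plane} (hx : x ∈ disk) : 0 < 1 - ‖x‖ ^ 2 := by
  have := mem_disk.1 hx
  nlinarith [norm_nonneg x]

theorem measurableSet_layer (δ : ℝ) : MeasurableSet (layer δ) := by
  have hm : Measurable fun x : Plane => 1 - ‖x‖ ^ 2 := by fun_prop
  exact measurableSet_disk.inter (measurableSet_lt hm measurable_const)

theorem layer_subset_disk (δ : ℝ) : layer δ ⊆ disk := fun _ hx => hx.1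

theorem layer_subset_annulus (δ : ℝ) : layer δ ⊆ annulus δ := by
  rintro x ⟨hx, h⟩
  have := mem_disk.1 hx
  exact ⟨by nlinarith [norm_nonneg x], this⟩

theorem annulus_subset_disk (δ : ℝ) : annulus δ ⊆ disk := fun _ hx => mem_disk.2 hx.2

theorem measurableSet_annulus (δ : ℝ) : MeasurableSet (annulus δ) :=
  (measurableSet_lt measurable_const measurable_norm).inter
    (measurableSet_lt measurable_norm measurable_const)

instance isFiniteMeasure_disk : IsFiniteMeasure (volume.restrict disk) :=
  ⟨by rw [Measure.restrict_apply_univ]; exact Metric.isBounded_ball.measure_lt_top⟩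

theorem volume_layer_le {δ : ℝ} (hδ : 0 ≤ δ) :
    volume.real (layer δ) ≤ Real.pi * δ := by
  rcases le_or_gt δ 1 with h1 | h1
  · have hsub : Metric.ball (0 : Plane) (√(1 - δ)) ⊆ disk :=
      Metric.ball_subset_ball (Real.sqrt_le_one.2 (by linarith))
    have hl : layer δ ⊆ disk \ Metric.ball (0 : Plane) (√(1 - δ)) := by
      rintro x ⟨hx, h⟩
      refine ⟨hx, fun hb => ?_⟩
      rw [mem_ball_zero_iff, Real.lt_sqrt (norm_nonneg x)] at hb
      linarith
    calc volume.real (layer δ) ≤ volume.real (disk \ Metric.ball (0 : Plane) (√(1 - δ))) :=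
          measureReal_mono hl ((measure_mono sdiff_subset).trans_lt
            Metric.isBounded_ball.measure_lt_top).ne
      _ = volume.real disk - volume.real (Metric.ball (0 : Plane) (√(1 - δ))) :=
          measureReal_sdiff hsub Metric.isOpen_ball.measurableSet
            Metric.isBounded_ball.measure_lt_top.ne
      _ ≤ Real.pi * δ := by
          simp only [disk, Measure.real, EuclideanSpace.volume_ball_fin_two]
          rw [ENNReal.toReal_mul, ENNReal.toReal_mul, ← ENNReal.ofReal_pow (by positivity),
            ← ENNReal.ofReal_pow (by positivity), Real.sq_sqrt (by linarith),
            ENNReal.toReal_ofReal (show (0 : ℝ) ≤ 1 - δ by linarith),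
            ENNReal.toReal_ofReal Real.pi_pos.le]
          norm_num
          linarith
  · calc volume.real (layer δ) ≤ volume.real disk :=
          measureReal_mono (layer_subset_disk δ) Metric.isBounded_ball.measure_lt_top.ne
      _ = Real.pi := by
          simp [disk, Measure.real, EuclideanSpace.volume_ball_fin_two, Real.pi_pos.le]
      _ ≤ Real.pi * δ := by nlinarith [Real.pi_pos]

theorem ExtendsTo.integrableOn {E : Type*} [NormedAddCommGroup E] [NormedSpace ℝ E]
    {f : Plane → E} (hf : ExtendsTo closedDisk disk f) : IntegrableOn f disk := by
  obtain ⟨g, hg, hfg⟩ := hf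
  exact ((hg.integrableOn_compact isCompact_closedDisk).mono_set disk_subset).congr_fun
    hfg.symm measurableSet_disk

theorem extendsTo_fderiv {E : Type*} [NormedAddCommGroup E] [NormedSpace ℝ E] {f : Plane → E}
    (hf : ContDiffOn ℝ 1 f closedDisk) : ExtendsTo closedDisk disk (fderiv ℝ f) :=
  ExtendsTo.fderiv hf uniqueDiffOn_closedDisk fun _ => closedDisk_mem_nhds

theorem differentiableAt_of_mem_disk {E : Type*} [NormedAddCommGroup E] [NormedSpace ℝ E]
    {f : Plane → E} (hf : ContDiffOn ℝ 1 f closedDisk) {x : Plane} (hx : x ∈ disk) :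
    DifferentiableAt ℝ f x :=
  (hf.contDiffAt (closedDisk_mem_nhds hx)).differentiableAt one_ne_zero

theorem sum_smul_basisVec (v : Plane) : ∑ i, v i • basisVec i = v := by
  ext j
  fin_cases j <;> simp [basisVec]

theorem inner_eq_sum (v w : Plane) : inner ℝ v w = ∑ i, v i * w i := by
  simp [PiLp.inner_apply, mul_comm]

/-! ### The divergence theorem on the disk -/

theorem hasFDerivAt_depth (x : Plane) :
    HasFDerivAt (fun x : Plane => 1 - ‖x‖ ^ 2) (-(2 • innerSL ℝ x)) x := by
  simpa using ((hasStrictFDerivAt_norm_sq x).hasFDerivAt.const_sub 1)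

theorem contDiff_depth {n : WithTop ℕ∞} : ContDiff ℝ n (fun x : Plane => 1 - ‖x‖ ^ 2) :=
  contDiff_const.sub (contDiff_norm_sq ℝ)

theorem inner_basisVec (x : Plane) (i : Fin 2) : inner ℝ x (basisVec i) = x i := by
  simp [basisVec, PiLp.inner_apply]

theorem hasFDerivAt_comp_depth {h : ℝ → ℝ} {x : Plane} {δ : ℝ}
    (hh : DifferentiableAt ℝ h ((1 - ‖x‖ ^ 2) / δ)) :
    HasFDerivAt (fun x : Plane => h ((1 - ‖x‖ ^ 2) / δ))
      ((-(2 * deriv h ((1 - ‖x‖ ^ 2) / δ) / δ)) • innerSL ℝ x) x := by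
  have h1 : HasFDerivAt (fun x : Plane => (1 - ‖x‖ ^ 2) / δ)
      (δ⁻¹ • (-(2 • innerSL ℝ x) : Plane →L[ℝ] ℝ)) x := by
    simpa only [div_eq_inv_mul] using (hasFDerivAt_depth x).const_mul δ⁻¹
  have h2 : HasFDerivAt (fun x : Plane => h ((1 - ‖x‖ ^ 2) / δ)) _ x :=
    hh.hasDerivAt.comp_hasFDerivAt x h1
  refine h2.congr_fderiv ?_
  ext v
  simp
  ring

/-- A continuous function on the closed disk that vanishes on the circle is uniformly small in thin
boundary layers. -/
theorem exists_layer_le {H : Plane → ℝ} (hH : ContinuousOn H closedDisk)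
    (h0 : ∀ x ∈ circle, H x = 0) {η : ℝ} (hη : 0 < η) :
    ∃ r > 0, ∀ x ∈ layer r, |H x| ≤ η := by
  have huc := isCompact_closedDisk.uniformContinuousOn_of_continuous hH
  obtain ⟨r, hr, hd⟩ := Metric.uniformContinuousOn_iff.1 huc η hη
  refine ⟨min r 1, by positivity, fun x hx => ?_⟩
  have hx1 := mem_disk.1 hx.1
  have hx2 : 1 - ‖x‖ ^ 2 < r := hx.2.trans_le (min_le_left _ _)
  have hx3 : 1 - ‖x‖ ^ 2 < 1 := hx.2.trans_le (min_le_right _ _)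
  have hx0 : 0 < ‖x‖ := by
    rcases (norm_nonneg x).eq_or_lt with h | h
    · rw [← h] at hx3; norm_num at hx3
    · exact h
  have hc : ‖x‖⁻¹ • x ∈ circle := by
    rw [mem_circle, norm_smul, norm_inv, norm_norm, inv_mul_cancel₀ hx0.ne']
  have hdist : dist x (‖x‖⁻¹ • x) < r := by
    have : x - ‖x‖⁻¹ • x = (1 - ‖x‖⁻¹) • x := by rw [sub_smul, one_smul]
    rw [dist_eq_norm, this, norm_smul, Real.norm_eq_abs, ← abs_norm x, ← abs_mul, abs_norm, sub_mul,
      inv_mul_cancel₀ hx0.ne', abs_lt]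
    constructor <;> nlinarith
  have := hd x (disk_subset hx.1) _ (circle_subset hc) hdist
  rw [h0 _ hc, Real.dist_eq, sub_zero] at this
  exact this.le

theorem continuous_deriv_smoothTransition : Continuous (deriv Real.smoothTransition) :=
  Real.smoothTransition.contDiff.continuous_deriv (n := 1) le_rfl

theorem deriv_smoothTransition_of_notMem {s : ℝ} (hs : s ∉ Icc (0 : ℝ) 1) :
    deriv Real.smoothTransition s = 0 := by
  rw [mem_Icc, not_and_or, not_le, not_le] at hs
  rcases hs with hs | hs
  · have : Real.smoothTransition =ᶠ[𝓝 s] fun _ => 0 := by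
      filter_upwards [Iio_mem_nhds hs] with y hy
      exact Real.smoothTransition.zero_of_nonpos (le_of_lt hy)
    rw [this.deriv_eq, deriv_const]
  · have : Real.smoothTransition =ᶠ[𝓝 s] fun _ => 1 := by
      filter_upwards [Ioi_mem_nhds hs] with y hy
      exact Real.smoothTransition.one_of_one_le (le_of_lt hy)
    rw [this.deriv_eq, deriv_const]

theorem exists_bound_deriv_smoothTransition :
    ∃ C, 0 ≤ C ∧ ∀ s, |deriv Real.smoothTransition s| ≤ C := by
  obtain ⟨C, hC⟩ := (HasCompactSupport.intro (isCompact_Icc (a := (0 : ℝ)) (b := 1))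
    fun s hs => deriv_smoothTransition_of_notMem hs).exists_bound_of_continuous
    continuous_deriv_smoothTransition
  exact ⟨C, (norm_nonneg _).trans (hC 0), hC⟩

/-- The cutoff function of the interior: it vanishes where `1 - |x|² ≤ ε` and is `1` where
`1 - |x|² ≥ 2ε`. -/
def interiorCutoff (ε : ℝ) (x : Plane) : ℝ := Real.smoothTransition ((1 - ‖x‖ ^ 2) / ε - 1)

theorem interiorCutoff_eq_zero {ε : ℝ} (hε : 0 < ε) {x : Plane} (hx : 1 - ‖x‖ ^ 2 ≤ ε) :
    interiorCutoff ε x = 0 :=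
  Real.smoothTransition.zero_of_nonpos (by rw [sub_nonpos, div_le_one hε]; exact hx)

theorem contDiff_interiorCutoff {n : ℕ∞} (ε : ℝ) : ContDiff ℝ n (interiorCutoff ε) :=
  Real.smoothTransition.contDiff.comp ((contDiff_depth.div_const ε).sub contDiff_const)

theorem fderiv_interiorCutoff (ε : ℝ) (x : Plane) (i : Fin 2) :
    fderiv ℝ (interiorCutoff ε) x (basisVec i)
      = -(2 * deriv Real.smoothTransition ((1 - ‖x‖ ^ 2) / ε - 1) / ε) * x i := by
  have hd : Differentiable ℝ Real.smoothTransition :=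
    (Real.smoothTransition.contDiff (n := 1)).differentiable one_ne_zero
  have h1 := hasFDerivAt_comp_depth (h := fun s => Real.smoothTransition (s - 1)) (x := x) (δ := ε)
    (by fun_prop)
  rw [deriv_comp_sub_const] at h1
  have h2 := h1.fderiv
  change fderiv ℝ (interiorCutoff ε) x = _ at h2
  rw [h2]
  simp [inner_basisVec]

/-- The cut off function, extended by zero, is differentiable on the plane; the integral of its
partial derivative vanishes. -/
theorem integral_fderiv_interiorCutoff_mul {f : Plane → ℝ} (hf : ContDiffOn ℝ 1 f closedDisk)
    {ε : ℝ} (hε : 0 < ε) (i : Fin 2) :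
    IntegrableOn (fun x => fderiv ℝ (fun x => interiorCutoff ε x * f x) x (basisVec i)) disk ∧
    ∫ x in disk, fderiv ℝ (fun x => interiorCutoff ε x * f x) x (basisVec i) = 0 := by
  set g : Plane → ℝ := fun x => interiorCutoff ε x * f x with hg
  set K : Set Plane := {x | ε ≤ 1 - ‖x‖ ^ 2} with hK
  have hKc : IsClosed K := isClosed_le continuous_const (by fun_prop)
  have hKd : K ⊆ disk := by
    intro x hx
    have : ε ≤ 1 - ‖x‖ ^ 2 := hx
    rw [mem_disk]
    nlinarith [norm_nonneg x]
  have hgK : ∀ x ∉ K, g x = 0 := by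
    intro x hx
    have hx' : ¬ (ε ≤ 1 - ‖x‖ ^ 2) := hx
    simp only [hg, interiorCutoff_eq_zero hε (not_le.1 hx').le, zero_mul]
  have hKcomp : IsCompact K := isCompact_closedDisk.of_isClosed_subset hKc (hKd.trans disk_subset)
  have hcs : HasCompactSupport g := HasCompactSupport.intro hKcomp hgK
  have hcd : ContDiff ℝ 1 g := by
    rw [contDiff_iff_contDiffAt]
    intro x
    by_cases hx : x ∈ K
    · exact (contDiff_interiorCutoff (n := 1) ε).contDiffAt.mul
        (hf.contDiffAt (closedDisk_mem_nhds (hKd hx)))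
    · have : g =ᶠ[𝓝 x] fun _ => 0 := by
        filter_upwards [hKc.isOpen_compl.mem_nhds hx] with y hy using hgK y hy
      exact contDiffAt_const.congr_of_eventuallyEq this
  have hfd : Continuous fun x => fderiv ℝ g x (basisVec i) :=
    (hcd.continuous_fderiv one_ne_zero).clm_apply continuous_const
  have hfi : Integrable fun x => fderiv ℝ g x (basisVec i) :=
    hfd.integrable_of_hasCompactSupport (hcs.fderiv_apply ℝ _)
  have hgi : Integrable g := hcd.continuous.integrable_of_hasCompactSupport hcs
  have h0 : ∫ x, fderiv ℝ g x (basisVec i) = 0 := by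
    have := integral_mul_fderiv_eq_neg_fderiv_mul_of_integrable (μ := volume)
      (f := fun _ : Plane => (1 : ℝ)) (g := g) (v := basisVec i)
      (by simp) (by simpa using hfi) (by simpa using hgi)
      (fun x _ => differentiableAt_const _) (fun x _ => hcd.differentiable one_ne_zero x)
    simpa using this
  refine ⟨hfi.integrableOn, ?_⟩
  rw [setIntegral_eq_integral_of_forall_compl_eq_zero, h0]
  intro x hx
  have hxK : x ∉ K := fun h => hx (hKd h)
  have : g =ᶠ[𝓝 x] fun _ => 0 := by
    filter_upwards [hKc.isOpen_compl.mem_nhds hxK] with y hy using hgK y hy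
  rw [this.fderiv_eq]
  simp

/-- The divergence theorem on the disk for fields without flux through the circle. -/
theorem integral_sum_fderiv_eq_zero (f : Fin 2 → Plane → ℝ)
    (hf : ∀ i, ContDiffOn ℝ 1 (f i) closedDisk) (h0 : ∀ x ∈ circle, ∑ i, x i * f i x = 0) :
    ∫ x in disk, ∑ i, fderiv ℝ (f i) x (basisVec i) = 0 := by
  set D : Plane → ℝ := fun x => ∑ i, fderiv ℝ (f i) x (basisVec i) with hD
  set H : Plane → ℝ := fun x => ∑ i, x i * f i x with hH
  have hDe : ExtendsTo closedDisk disk D :=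
    ExtendsTo.sum _ fun i => (extendsTo_fderiv (hf i)).clm_apply (ExtendsTo.const _)
  have hHc : ContinuousOn H closedDisk :=
    continuousOn_finsetSum _ fun i _ =>
      (by fun_prop : Continuous fun x : Plane => x i).continuousOn.mul (hf i).continuousOn
  obtain ⟨C, hC0, hC⟩ := exists_bound_deriv_smoothTransition
  set R : ℝ → Plane → ℝ := fun ε x =>
    2 * deriv Real.smoothTransition ((1 - ‖x‖ ^ 2) / ε - 1) / ε * H x with hR
  have hRint : ∀ ε, IntegrableOn (R ε) disk := by
    intro ε
    refine ExtendsTo.integrableOn (.of_continuousOn (ContinuousOn.mul ?_ hHc))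
    have := continuous_deriv_smoothTransition
    exact Continuous.continuousOn (by fun_prop)
  have hCD : ∀ ε, IntegrableOn (fun x => interiorCutoff ε x * D x) disk := fun ε =>
    ((ExtendsTo.of_continuousOn (contDiff_interiorCutoff (n := 0) ε).continuous.continuousOn).mul
      hDe).integrableOn
  -- The product rule turns the vanishing integral of the cut off field into a flux identity.
  have key : ∀ ε > 0, ∫ x in disk, interiorCutoff ε x * D x = ∫ x in disk, R ε x := by
    intro ε hε
    have h1 : ∫ x in disk, ∑ i, fderiv ℝ (fun x => interiorCutoff ε x * f i x) x (basisVec i)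
        = 0 := by
      rw [integral_finsetSum _ fun i _ => (integral_fderiv_interiorCutoff_mul (hf i) hε i).1]
      exact Finset.sum_eq_zero fun i _ => (integral_fderiv_interiorCutoff_mul (hf i) hε i).2
    have h2 : ∀ x ∈ disk, ∑ i, fderiv ℝ (fun x => interiorCutoff ε x * f i x) x (basisVec i)
        = interiorCutoff ε x * D x - R ε x := by
      intro x hx
      have h3 : ∀ i, fderiv ℝ (fun x => interiorCutoff ε x * f i x) x (basisVec i)
          = interiorCutoff ε x * fderiv ℝ (f i) x (basisVec i)
            - 2 * deriv Real.smoothTransition ((1 - ‖x‖ ^ 2) / ε - 1) / ε * (x i * f i x) := by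
        intro i
        rw [fderiv_fun_mul (((contDiff_interiorCutoff (n := 1) ε).differentiable one_ne_zero) x)
          (differentiableAt_of_mem_disk (hf i) hx)]
        simp only [add_apply, smul_apply, fderiv_interiorCutoff, smul_eq_mul]
        ring
      simp only [h3, Finset.sum_sub_distrib, ← Finset.mul_sum, hD, hR, hH]
    rw [setIntegral_congr_fun measurableSet_disk h2, integral_sub (hCD ε) (hRint ε)] at h1
    linarith
  have lim1 : Tendsto (fun ε => ∫ x in disk, interiorCutoff ε x * D x) (𝓝[>] 0)
      (𝓝 (∫ x in disk, D x)) := by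
    refine tendsto_integral_filter_of_dominated_convergence (fun x => ‖D x‖)
      (Eventually.of_forall fun ε => (hCD ε).1) ?_ hDe.integrableOn.norm ?_
    · refine Eventually.of_forall fun ε => Eventually.of_forall fun x => ?_
      rw [norm_mul, Real.norm_eq_abs, interiorCutoff,
        abs_of_nonneg (Real.smoothTransition.nonneg _)]
      exact mul_le_of_le_one_left (norm_nonneg _) (Real.smoothTransition.le_one _)
    · refine (ae_restrict_mem measurableSet_disk).mono fun x hx => ?_
      refine tendsto_const_nhds.congr' ?_
      have hp := depth_pos hx
      filter_upwards [Ioo_mem_nhdsGT (show (0 : ℝ) < (1 - ‖x‖ ^ 2) / 2 by linarith)] with ε hε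
      rw [interiorCutoff, Real.smoothTransition.one_of_one_le, one_mul]
      rw [le_sub_iff_add_le, le_div_iff₀ hε.1]
      linarith [hε.2]
  have lim2 : Tendsto (fun ε => ∫ x in disk, R ε x) (𝓝[>] 0) (𝓝 0) := by
    rw [Metric.tendsto_nhdsWithin_nhds]
    intro η hη
    set M := 4 * C * Real.pi + 1 with hM
    have hMp : 0 < 4 * C * Real.pi + 1 := by positivity
    obtain ⟨r, hr, hlay⟩ := exists_layer_le hHc h0 (show 0 < η / (2 * M) by positivity)
    refine ⟨r / 3, by positivity, fun {ε} hε hεr => ?_⟩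
    have hε0 : 0 < ε := hε
    rw [Real.dist_eq, sub_zero, abs_of_pos hε0] at hεr
    -- The integrand lives on the layer of width `3ε`, whose measure compensates the factor `1/ε`.
    have hbd : ∀ x ∈ disk, ‖R ε x‖ ≤ (layer (3 * ε)).indicator
        (fun _ => 2 * C / ε * (η / (2 * M))) x := by
      intro x hx
      by_cases hxl : x ∈ layer (3 * ε)
      · rw [indicator_of_mem hxl, Real.norm_eq_abs, abs_mul, abs_div, abs_mul, abs_two,
          abs_of_pos hε0]
        gcongr
        · exact hC _
        · exact hlay x ⟨hx, hxl.2.trans (by linarith)⟩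
      · rw [indicator_of_notMem hxl]
        have : ¬ (1 - ‖x‖ ^ 2 < 3 * ε) := fun h => hxl ⟨hx, h⟩
        have hz : deriv Real.smoothTransition ((1 - ‖x‖ ^ 2) / ε - 1) = 0 := by
          refine deriv_smoothTransition_of_notMem fun h => this ?_
          have h2 := h.2
          rw [sub_le_iff_le_add, div_le_iff₀ hε0] at h2
          linarith
        simp [hR, hz]
    have hvol := volume_layer_le (show 0 ≤ 3 * ε by positivity)
    rw [Real.dist_eq, sub_zero]
    calc |∫ x in disk, R ε x| ≤ ∫ x in disk, ‖R ε x‖ := by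
          rw [← Real.norm_eq_abs]; exact norm_integral_le_integral_norm _
      _ ≤ ∫ x in disk, (layer (3 * ε)).indicator (fun _ => 2 * C / ε * (η / (2 * M))) x := by
          refine setIntegral_mono_on (hRint ε).norm ?_ measurableSet_disk hbd
          exact (integrable_const _).indicator (measurableSet_layer _)
      _ = volume.real (layer (3 * ε)) * (2 * C / ε * (η / (2 * M))) := by
          rw [setIntegral_indicator (measurableSet_layer _),
            inter_eq_self_of_subset_right (layer_subset_disk _), setIntegral_const, smul_eq_mul]
      _ ≤ Real.pi * (3 * ε) * (2 * C / ε * (η / (2 * M))) := by gcongr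
      _ = η * ((3 * C * Real.pi) / M) := by field_simp
      _ < η := by
          refine mul_lt_of_lt_one_right hη ?_
          rw [div_lt_one hMp]
          nlinarith [mul_nonneg hC0 Real.pi_pos.le]
  refine tendsto_nhds_unique lim1 (lim2.congr' ?_)
  filter_upwards [self_mem_nhdsWithin] with ε hε using (key ε hε).symm

/-! ### Integration by parts for fields on the disk -/

theorem fderiv_coord {w : Plane → Plane} {x : Plane} (hw : DifferentiableAt ℝ w x) (i : Fin 2)
    (v : Plane) : fderiv ℝ (fun x => w x i) x v = fderiv ℝ w x v i := by
  have := ((EuclideanSpace.proj i : Plane →L[ℝ] ℝ).hasFDerivAt.comp x hw.hasFDerivAt).fderiv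
  change fderiv ℝ (fun x => w x i) x = _ at this
  rw [this]
  rfl

theorem fderiv_eq_sum {E : Type*} [NormedAddCommGroup E] [NormedSpace ℝ E] (L : Plane →L[ℝ] E)
    (v : Plane) : L v = ∑ i, v i • L (basisVec i) := by
  conv_lhs => rw [← sum_smul_basisVec v]
  simp only [map_sum, map_smul]

theorem contDiffOn_coord {w : Plane → Plane} {n : WithTop ℕ∞} {K : Set Plane}
    (hw : ContDiffOn ℝ n w K) (i : Fin 2) : ContDiffOn ℝ n (fun x => w x i) K :=
  (EuclideanSpace.proj i : Plane →L[ℝ] ℝ).contDiff.comp_contDiffOn hw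

/-- A divergence-free tangential field transports functions without changing their integral. -/
theorem integral_fderiv_apply_eq_zero {w : Plane → Plane} {f : Plane → ℝ}
    (hw : ContDiffOn ℝ 1 w closedDisk) (hdiv : ∀ x ∈ disk, divergence w x = 0)
    (hbc : ∀ x ∈ circle, inner ℝ (w x) x = 0) (hf : ContDiffOn ℝ 1 f closedDisk) :
    ∫ x in disk, fderiv ℝ f x (w x) = 0 := by
  rw [← integral_sum_fderiv_eq_zero (fun i x => w x i * f x)
    (fun i => (contDiffOn_coord hw i).mul hf) ?_]
  · refine setIntegral_congr_fun measurableSet_disk fun x hx => ?_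
    have hwx := differentiableAt_of_mem_disk hw hx
    have hfx := differentiableAt_of_mem_disk hf hx
    have h1 : ∀ i, fderiv ℝ (fun x => w x i * f x) x (basisVec i)
        = w x i • fderiv ℝ f x (basisVec i) + f x * partialDeriv i w x i := by
      intro i
      rw [fderiv_fun_mul (differentiableAt_of_mem_disk (contDiffOn_coord hw i) hx) hfx]
      simp only [add_apply, smul_apply, fderiv_coord hwx, smul_eq_mul]
      rfl
    have h2 := hdiv x hx
    rw [divergence] at h2
    simp only [h1, Finset.sum_add_distrib, ← Finset.mul_sum, h2, mul_zero, add_zero]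
    exact fderiv_eq_sum _ _
  · intro x hx
    have := hbc x hx
    rw [inner_eq_sum] at this
    calc ∑ i, x i * (w x i * f x) = (∑ i, w x i * x i) * f x := by
          rw [Finset.sum_mul]; exact Finset.sum_congr rfl fun i _ => by ring
      _ = 0 := by rw [this, zero_mul]

theorem integral_inner_gradient_eq_zero {w : Plane → Plane} {p : Plane → ℝ}
    (hw : ContDiffOn ℝ 1 w closedDisk) (hdiv : ∀ x ∈ disk, divergence w x = 0)
    (hbc : ∀ x ∈ circle, inner ℝ (w x) x = 0) (hp : ContDiffOn ℝ 1 p closedDisk) :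
    ∫ x in disk, inner ℝ (gradient p x) (w x) = 0 := by
  simpa only [inner_gradient_left] using integral_fderiv_apply_eq_zero hw hdiv hbc hp

/-- The convection operator of a divergence-free tangential field is antisymmetric. -/
theorem integral_inner_convection {w a b : Plane → Plane}
    (hw : ContDiffOn ℝ 1 w closedDisk) (hdiv : ∀ x ∈ disk, divergence w x = 0)
    (hbc : ∀ x ∈ circle, inner ℝ (w x) x = 0) (ha : ContDiffOn ℝ 1 a closedDisk)
    (hb : ContDiffOn ℝ 1 b closedDisk) :
    ∫ x in disk, inner ℝ (fderiv ℝ a x (w x)) (b x)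
      = -∫ x in disk, inner ℝ (a x) (fderiv ℝ b x (w x)) := by
  have hwe : ExtendsTo closedDisk disk w := .of_continuousOn hw.continuousOn
  have h1 : IntegrableOn (fun x => inner ℝ (fderiv ℝ a x (w x)) (b x)) disk :=
    (((extendsTo_fderiv ha).clm_apply hwe).inner (.of_continuousOn hb.continuousOn)).integrableOn
  have h2 : IntegrableOn (fun x => inner ℝ (a x) (fderiv ℝ b x (w x))) disk :=
    (ExtendsTo.inner (.of_continuousOn ha.continuousOn)
      ((extendsTo_fderiv hb).clm_apply hwe)).integrableOn
  rw [eq_neg_iff_add_eq_zero, ← integral_add h1 h2,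
    ← integral_fderiv_apply_eq_zero hw hdiv hbc (ha.inner ℝ hb)]
  refine setIntegral_congr_fun measurableSet_disk fun x hx => ?_
  rw [fderiv_inner_apply ℝ (differentiableAt_of_mem_disk ha hx)
    (differentiableAt_of_mem_disk hb hx)]
  ring

theorem integral_inner_convection_self {w a : Plane → Plane}
    (hw : ContDiffOn ℝ 1 w closedDisk) (hdiv : ∀ x ∈ disk, divergence w x = 0)
    (hbc : ∀ x ∈ circle, inner ℝ (w x) x = 0) (ha : ContDiffOn ℝ 1 a closedDisk) :
    ∫ x in disk, inner ℝ (a x) (fderiv ℝ a x (w x)) = 0 := by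
  have h := integral_inner_convection hw hdiv hbc ha ha
  have h' : ∀ x, inner ℝ (fderiv ℝ a x (w x)) (a x) = inner ℝ (a x) (fderiv ℝ a x (w x)) :=
    fun x => real_inner_comm _ _
  simp only [h'] at h
  linarith

/-- The pairing `∇u : ∇v` of Jacobian matrices. -/
def gradInner (u v : Plane → Plane) (x : Plane) : ℝ :=
  ∑ i, inner ℝ (partialDeriv i u x) (partialDeriv i v x)

theorem gradInner_self (u : Plane → Plane) (x : Plane) : gradInner u u x = gradNormSq u x := by
  simp [gradInner, gradNormSq]

theorem gradNormSq_nonneg (u : Plane → Plane) (x : Plane) : 0 ≤ gradNormSq u x :=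
  Finset.sum_nonneg fun _ _ => by positivity

theorem extendsTo_gradInner {u v : Plane → Plane} (hu : ContDiffOn ℝ 1 u closedDisk)
    (hv : ContDiffOn ℝ 1 v closedDisk) : ExtendsTo closedDisk disk (gradInner u v) :=
  ExtendsTo.sum _ fun _ => ((extendsTo_fderiv hu).clm_apply (.const _)).inner
    ((extendsTo_fderiv hv).clm_apply (.const _))

theorem extendsTo_gradNormSq {u : Plane → Plane} (hu : ContDiffOn ℝ 1 u closedDisk) :
    ExtendsTo closedDisk disk (gradNormSq u) :=
  (extendsTo_gradInner hu hu).congr fun x _ => (gradInner_self u x).symm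

theorem laplacian_eq_sum (u : Plane → Plane) (x : Plane) :
    Laplacian.laplacian u x = ∑ i, fderiv ℝ (fderiv ℝ u) x (basisVec i) (basisVec i) := by
  rw [InnerProductSpace.laplacian_eq_iteratedFDeriv_orthonormalBasis u
    (EuclideanSpace.basisFun (Fin 2) ℝ)]
  simp [iteratedFDeriv_two_apply]

theorem extendsTo_laplacian {u : Plane → Plane} (hu : ContDiffOn ℝ 2 u closedDisk) :
    ExtendsTo closedDisk disk (Laplacian.laplacian u) := by
  have h1 : ContDiffOn ℝ 1 (fderivWithin ℝ u closedDisk) closedDisk :=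
    hu.fderivWithin uniqueDiffOn_closedDisk (by norm_num)
  have h2 : ExtendsTo closedDisk disk (fderiv ℝ (fderiv ℝ u)) := by
    refine (extendsTo_fderiv h1).congr fun x hx => Filter.EventuallyEq.fderiv_eq ?_
    filter_upwards [isOpen_disk.mem_nhds hx] with y hy
    exact (fderivWithin_of_mem_nhds (closedDisk_mem_nhds hy)).symm
  refine (ExtendsTo.sum Finset.univ fun i : Fin 2 =>
    (h2.clm_apply (.const (basisVec i))).clm_apply (.const (basisVec i))).congr fun x _ => ?_
  exact laplacian_eq_sum u x

/-- Green's formula for a field `φ` that vanishes on the circle. -/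
theorem integral_inner_laplacian {u φ : Plane → Plane} (hu : ContDiffOn ℝ 2 u closedDisk)
    (hφ : ContDiffOn ℝ 1 φ closedDisk) (h0 : ∀ x ∈ circle, φ x = 0) :
    ∫ x in disk, inner ℝ (Laplacian.laplacian u x) (φ x) = -∫ x in disk, gradInner u φ x := by
  have h1 : ContDiffOn ℝ 1 (fderivWithin ℝ u closedDisk) closedDisk :=
    hu.fderivWithin uniqueDiffOn_closedDisk (by norm_num)
  have hu1 : ContDiffOn ℝ 1 u closedDisk := hu.of_le (by norm_num)
  have hi1 : IntegrableOn (fun x => inner ℝ (Laplacian.laplacian u x) (φ x)) disk :=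
    ((extendsTo_laplacian hu).inner (.of_continuousOn hφ.continuousOn)).integrableOn
  rw [eq_neg_iff_add_eq_zero, ← integral_add hi1 (extendsTo_gradInner hu1 hφ).integrableOn,
    ← integral_sum_fderiv_eq_zero
      (fun i x => inner ℝ (fderivWithin ℝ u closedDisk x (basisVec i)) (φ x))
      (fun i => (h1.clm_apply contDiffOn_const).inner ℝ hφ)
      (fun x hx => by simp [h0 x hx])]
  refine setIntegral_congr_fun measurableSet_disk fun x hx => ?_
  have hux : ContDiffAt ℝ 2 u x := hu.contDiffAt (closedDisk_mem_nhds hx)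
  have hd : DifferentiableAt ℝ (fderiv ℝ u) x :=
    (hux.fderiv_right (m := 1) (by norm_num)).differentiableAt one_ne_zero
  have h2 : ∀ i, fderiv ℝ (fun x => inner ℝ (fderivWithin ℝ u closedDisk x (basisVec i)) (φ x)) x
      (basisVec i) = inner ℝ (fderiv ℝ (fderiv ℝ u) x (basisVec i) (basisVec i)) (φ x)
        + inner ℝ (partialDeriv i u x) (partialDeriv i φ x) := by
    intro i
    have he : (fun x => inner ℝ (fderivWithin ℝ u closedDisk x (basisVec i)) (φ x))
        =ᶠ[𝓝 x] fun x => inner ℝ (fderiv ℝ u x (basisVec i)) (φ x) := by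
      filter_upwards [isOpen_disk.mem_nhds hx] with y hy
      rw [fderivWithin_of_mem_nhds (closedDisk_mem_nhds hy)]
    rw [he.fderiv_eq, fderiv_inner_apply ℝ (hd.clm_apply (differentiableAt_const _))
      (differentiableAt_of_mem_disk hφ hx), fderiv_clm_apply hd (differentiableAt_const _)]
    simp [partialDeriv, add_comm]
  simp only [h2, Finset.sum_add_distrib, laplacian_eq_sum, sum_inner, gradInner]

/-! ### Poincaré's inequality in the boundary layer -/

theorem norm_fderiv_apply_sq_le (u : Plane → Plane) (x v : Plane) :
    ‖fderiv ℝ u x v‖ ^ 2 ≤ gradNormSq u x * ‖v‖ ^ 2 := by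
  have h1 : ‖fderiv ℝ u x v‖ ≤ ∑ i, |v i| * ‖partialDeriv i u x‖ := by
    rw [fderiv_eq_sum]
    refine (norm_sum_le _ _).trans_eq (Finset.sum_congr rfl fun i _ => ?_)
    rw [norm_smul, Real.norm_eq_abs]
    rfl
  calc ‖fderiv ℝ u x v‖ ^ 2 ≤ (∑ i, |v i| * ‖partialDeriv i u x‖) ^ 2 := by gcongr
    _ ≤ (∑ i, |v i| ^ 2) * ∑ i, ‖partialDeriv i u x‖ ^ 2 :=
        Finset.sum_mul_sq_le_sq_mul_sq _ _ _
    _ = gradNormSq u x * ‖v‖ ^ 2 := by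
        rw [EuclideanSpace.norm_sq_eq, gradNormSq, mul_comm]
        simp

theorem gradNormSq_le (u : Plane → Plane) (x : Plane) :
    gradNormSq u x ≤ 2 * ‖fderiv ℝ u x‖ ^ 2 := by
  have h : ∀ i, ‖partialDeriv i u x‖ ^ 2 ≤ ‖fderiv ℝ u x‖ ^ 2 := fun i => by
    have := (fderiv ℝ u x).le_opNorm (basisVec i)
    simp only [basisVec, PiLp.norm_single, norm_one, mul_one] at this
    exact pow_le_pow_left₀ (norm_nonneg _) this 2
  calc gradNormSq u x ≤ ∑ _i : Fin 2, ‖fderiv ℝ u x‖ ^ 2 := Finset.sum_le_sum fun i _ => h i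
    _ = 2 * ‖fderiv ℝ u x‖ ^ 2 := by simp

theorem hasDerivAt_max_zero_sq (s : ℝ) :
    HasDerivAt (fun s : ℝ => max s 0 ^ 2) (2 * max s 0) s := by
  rcases lt_trichotomy s 0 with h | h | h
  · have : (fun s : ℝ => max s 0 ^ 2) =ᶠ[𝓝 s] fun _ => 0 := by
      filter_upwards [Iio_mem_nhds h] with y hy
      rw [max_eq_right (le_of_lt hy)]; norm_num
    rw [max_eq_right h.le, mul_zero]
    exact (hasDerivAt_const s 0).congr_of_eventuallyEq this
  · subst h
    rw [max_self, mul_zero, hasDerivAt_iff_isLittleO_nhds_zero]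
    have h2 : (fun h : ℝ => max (0 + h) 0 ^ 2 - max 0 0 ^ 2 - h • (0 : ℝ))
        =O[𝓝 0] fun h : ℝ => h ^ 2 := by
      refine Asymptotics.isBigO_of_le _ fun h => ?_
      simp only [zero_add, max_self, smul_zero, sub_zero]
      norm_num
      rcases le_total h 0 with h' | h'
      · rw [max_eq_right h']; simpa using sq_nonneg h
      · rw [max_eq_left h']
    refine h2.trans_isLittleO ?_
    exact Asymptotics.isLittleO_pow_id (by norm_num)
  · have : (fun s : ℝ => max s 0 ^ 2) =ᶠ[𝓝 s] fun s => s ^ 2 := by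
      filter_upwards [Ioi_mem_nhds h] with y hy
      rw [max_eq_left (le_of_lt hy)]
    rw [max_eq_left h.le]
    simpa using (hasDerivAt_pow 2 s).congr_of_eventuallyEq this

theorem contDiff_max_zero_sq : ContDiff ℝ 1 (fun s : ℝ => max s 0 ^ 2) := by
  rw [contDiff_one_iff_deriv]
  refine ⟨fun s => (hasDerivAt_max_zero_sq s).differentiableAt, ?_⟩
  have : deriv (fun s : ℝ => max s 0 ^ 2) = fun s => 2 * max s 0 :=
    funext fun s => (hasDerivAt_max_zero_sq s).deriv
  rw [this]
  fun_prop

/-- Poincaré's inequality with the weight `q = (r - (1 - |x|²))₊`. It follows by integrating the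
divergence of the field `q² |u|² x`. -/
theorem integral_weight_le {u : Plane → Plane} (hu : ContDiffOn ℝ 1 u closedDisk)
    (h0 : ∀ x ∈ circle, u x = 0) {r : ℝ} (hr0 : 0 < r) (hr : r ≤ 1 / 2) :
    ∫ x in disk, max (r - (1 - ‖x‖ ^ 2)) 0 * ‖u x‖ ^ 2
      ≤ r ^ 2 * ∫ x in disk, max (r - (1 - ‖x‖ ^ 2)) 0 * gradNormSq u x := by
  set q : Plane → ℝ := fun x => max (r - (1 - ‖x‖ ^ 2)) 0 with hq
  have hqc : ExtendsTo closedDisk disk q := .of_continuousOn (Continuous.continuousOn (by fun_prop))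
  have hue : ExtendsTo closedDisk disk u := .of_continuousOn hu.continuousOn
  have hqd : ContDiff ℝ 1 fun x => q x ^ 2 :=
    contDiff_max_zero_sq.comp (contDiff_const.sub contDiff_depth)
  have hqf : ∀ x i, fderiv ℝ (fun x => q x ^ 2) x (basisVec i) = 4 * q x * x i := by
    intro x i
    have h1 : HasFDerivAt (fun x : Plane => r - (1 - ‖x‖ ^ 2))
        (-(-(2 • innerSL ℝ x) : Plane →L[ℝ] ℝ)) x := (hasFDerivAt_depth x).const_sub r
    have h2 := ((hasDerivAt_max_zero_sq (r - (1 - ‖x‖ ^ 2))).comp_hasFDerivAt x h1).fderiv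
    change fderiv ℝ (fun x => q x ^ 2) x = _ at h2
    rw [h2]
    simp [inner_basisVec, hq]
    ring
  have hdiv := integral_sum_fderiv_eq_zero (fun i x => x i * (q x ^ 2 * ‖u x‖ ^ 2))
    (fun i => (contDiffOn_coord contDiffOn_id i).mul (hqd.contDiffOn.mul (hu.norm_sq ℝ)))
    (fun x hx => by simp [h0 x hx])
  have hpt : ∀ x ∈ disk, q x * ‖u x‖ ^ 2 - r ^ 2 * (q x * gradNormSq u x)
      ≤ ∑ i, fderiv ℝ (fun x => x i * (q x ^ 2 * ‖u x‖ ^ 2)) x (basisVec i) := by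
    intro x hx
    have hux := differentiableAt_of_mem_disk hu hx
    have h1 : ∀ i, fderiv ℝ (fun x => x i * (q x ^ 2 * ‖u x‖ ^ 2)) x (basisVec i)
        = q x ^ 2 * ‖u x‖ ^ 2 + (x i * x i) * (4 * q x * ‖u x‖ ^ 2)
          + 2 * q x ^ 2 * (x i * inner ℝ (u x) (fderiv ℝ u x (basisVec i))) := by
      intro i
      have hxi : DifferentiableAt ℝ (fun x : Plane => x i) x := by fun_prop
      have hqx := hqd.differentiable one_ne_zero x
      have hu2 : fderiv ℝ (fun x => ‖u x‖ ^ 2) x (basisVec i)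
          = 2 * inner ℝ (u x) (fderiv ℝ u x (basisVec i)) := by
        rw [hux.hasFDerivAt.norm_sq.fderiv]; simp
      have hqu : DifferentiableAt ℝ (fun x => q x ^ 2 * ‖u x‖ ^ 2) x := hqx.mul (hux.norm_sq ℝ)
      rw [fderiv_fun_mul hxi hqu, fderiv_fun_mul hqx (hux.norm_sq ℝ)]
      simp only [add_apply, smul_apply, smul_eq_mul, hqf]
      rw [fderiv_coord (w := fun x => x) differentiableAt_id i, hu2]
      simp
      ring
    have h2 : ∑ i, fderiv ℝ (fun x => x i * (q x ^ 2 * ‖u x‖ ^ 2)) x (basisVec i)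
        = 2 * (q x ^ 2 * ‖u x‖ ^ 2) + ‖x‖ ^ 2 * (4 * q x * ‖u x‖ ^ 2)
          + 2 * q x ^ 2 * inner ℝ (u x) (fderiv ℝ u x x) := by
      have h3 : inner ℝ (u x) (fderiv ℝ u x x)
          = ∑ i, x i * inner ℝ (u x) (fderiv ℝ u x (basisVec i)) := by
        rw [fderiv_eq_sum (fderiv ℝ u x) x, inner_sum]
        simp only [inner_smul_right]
      rw [h3, ← real_inner_self_eq_norm_sq x, inner_eq_sum]
      simp only [h1, Finset.sum_add_distrib, ← Finset.mul_sum, ← Finset.sum_mul]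
      simp
      ring
    rw [h2]
    have hx1 := mem_disk.1 hx
    have hq0 : 0 ≤ q x := le_max_right _ _
    have hqr : q x ≤ r := max_le (by linarith [depth_pos hx]) hr0.le
    have hx2 : q x * (1 / 2) ≤ q x * ‖x‖ ^ 2 := by
      rcases le_total (r - (1 - ‖x‖ ^ 2)) 0 with h | h
      · simp [hq, max_eq_right h]
      · gcongr; linarith
    set N := ‖fderiv ℝ u x x‖ with hN
    have hNg : N ^ 2 ≤ gradNormSq u x := by
      refine (norm_fderiv_apply_sq_le u x x).trans ?_
      exact mul_le_of_le_one_right (gradNormSq_nonneg u x)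
        (pow_le_one₀ (norm_nonneg _) hx1.le)
    have hin : -(‖u x‖ * N) ≤ inner ℝ (u x) (fderiv ℝ u x x) :=
      (abs_le.1 (abs_real_inner_le_norm _ _)).1
    have e1 : -(2 * q x ^ 2 * (‖u x‖ * N)) ≤ 2 * q x ^ 2 * inner ℝ (u x) (fderiv ℝ u x x) := by
      have := mul_le_mul_of_nonneg_left hin (show 0 ≤ 2 * q x ^ 2 by positivity)
      linarith
    have e2 : 2 * q x ^ 2 * (‖u x‖ * N) ≤ q x * ‖u x‖ ^ 2 + q x * (q x ^ 2 * N ^ 2) := by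
      nlinarith [mul_nonneg hq0 (sq_nonneg (‖u x‖ - q x * N))]
    have e3 : q x * (q x ^ 2 * N ^ 2) ≤ r ^ 2 * (q x * gradNormSq u x) := by
      have : q x ^ 2 * N ^ 2 ≤ r ^ 2 * gradNormSq u x := by gcongr
      nlinarith [mul_le_mul_of_nonneg_left this hq0]
    have e4 : q x * (1 / 2) * (4 * ‖u x‖ ^ 2) ≤ q x * ‖x‖ ^ 2 * (4 * ‖u x‖ ^ 2) := by gcongr
    have e5 : 0 ≤ q x ^ 2 * ‖u x‖ ^ 2 := by positivity
    linarith
  have i1 : IntegrableOn (fun x => q x * ‖u x‖ ^ 2) disk := (hqc.mul hue.norm_sq).integrableOn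
  have i2 : IntegrableOn (fun x => q x * gradNormSq u x) disk :=
    (hqc.mul (extendsTo_gradNormSq hu)).integrableOn
  have i3 : IntegrableOn (fun x => ∑ i, fderiv ℝ (fun x => x i * (q x ^ 2 * ‖u x‖ ^ 2)) x
      (basisVec i)) disk :=
    (ExtendsTo.sum _ fun i => (extendsTo_fderiv ((contDiffOn_coord contDiffOn_id i).mul
      (hqd.contDiffOn.mul (hu.norm_sq ℝ)))).clm_apply (.const _)).integrableOn
  have := setIntegral_mono_on (i1.sub (i2.const_mul (r ^ 2))) i3 measurableSet_disk hpt
  rw [hdiv] at this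
  change ∫ x in disk, (q x * ‖u x‖ ^ 2 - r ^ 2 * (q x * gradNormSq u x)) ≤ 0 at this
  rw [integral_sub i1 (i2.const_mul (r ^ 2)), integral_const_mul] at this
  linarith

/-- Poincaré's inequality in the layer of width `δ`. The layer on the right is twice as wide because
the weight of `integral_weight_le` degenerates at the inner edge. -/
theorem integral_layer_norm_sq_le {u : Plane → Plane} (hu : ContDiffOn ℝ 1 u closedDisk)
    (h0 : ∀ x ∈ circle, u x = 0) {δ : ℝ} (hδ0 : 0 < δ) (hδ : 2 * δ ≤ 1 / 2) :
    ∫ x in layer δ, ‖u x‖ ^ 2 ≤ 8 * δ ^ 2 * ∫ x in layer (2 * δ), gradNormSq u x := by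
  have hue : ExtendsTo closedDisk disk u := .of_continuousOn hu.continuousOn
  set q : Plane → ℝ := fun x => max (2 * δ - (1 - ‖x‖ ^ 2)) 0 with hq
  have hqc : ExtendsTo closedDisk disk q := .of_continuousOn (Continuous.continuousOn (by fun_prop))
  have hw := integral_weight_le hu h0 (show 0 < 2 * δ by positivity) hδ
  have i0 : IntegrableOn (fun x => ‖u x‖ ^ 2) disk := hue.norm_sq.integrableOn
  have i1 : IntegrableOn (fun x => q x * ‖u x‖ ^ 2) disk := (hqc.mul hue.norm_sq).integrableOn
  have i2 : IntegrableOn (fun x => q x * gradNormSq u x) disk :=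
    (hqc.mul (extendsTo_gradNormSq hu)).integrableOn
  have i3 : IntegrableOn (gradNormSq u) disk := (extendsTo_gradNormSq hu).integrableOn
  have h1 : δ * ∫ x in layer δ, ‖u x‖ ^ 2 ≤ ∫ x in disk, q x * ‖u x‖ ^ 2 := by
    rw [← integral_const_mul]
    calc ∫ x in layer δ, δ * ‖u x‖ ^ 2 ≤ ∫ x in layer δ, q x * ‖u x‖ ^ 2 := by
          refine setIntegral_mono_on ((i0.mono_set (layer_subset_disk _)).const_mul δ)
            (i1.mono_set (layer_subset_disk _)) (measurableSet_layer _) fun x hx => ?_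
          have hx2 := hx.2
          gcongr
          exact le_max_of_le_left (by linarith)
      _ ≤ ∫ x in disk, q x * ‖u x‖ ^ 2 :=
          setIntegral_mono_set i1
            (Eventually.of_forall fun x => mul_nonneg (le_max_right _ _) (sq_nonneg _))
            (layer_subset_disk _).eventuallyLE
  have h2 : ∫ x in disk, q x * gradNormSq u x
      ≤ 2 * δ * ∫ x in layer (2 * δ), gradNormSq u x := by
    rw [← integral_const_mul, ← inter_eq_self_of_subset_right (layer_subset_disk (2 * δ)),
      ← setIntegral_indicator (measurableSet_layer _)]
    refine setIntegral_mono_on i2 ((i3.const_mul _).indicator (measurableSet_layer _))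
      measurableSet_disk fun x hx => ?_
    by_cases hxl : x ∈ layer (2 * δ)
    · rw [indicator_of_mem hxl]
      refine mul_le_mul_of_nonneg_right ?_ (gradNormSq_nonneg u x)
      exact max_le (by linarith [depth_pos hx]) (by positivity)
    · rw [indicator_of_notMem hxl]
      have h3 : ¬ (1 - ‖x‖ ^ 2 < 2 * δ) := fun h => hxl ⟨hx, h⟩
      simp [hq, max_eq_right (show 2 * δ - (1 - ‖x‖ ^ 2) ≤ 0 by linarith)]
  have h3 : δ * ∫ x in layer δ, ‖u x‖ ^ 2
      ≤ δ * (8 * δ ^ 2 * ∫ x in layer (2 * δ), gradNormSq u x) := by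
    calc δ * ∫ x in layer δ, ‖u x‖ ^ 2 ≤ (2 * δ) ^ 2 * ∫ x in disk, q x * gradNormSq u x :=
          h1.trans hw
      _ ≤ (2 * δ) ^ 2 * (2 * δ * ∫ x in layer (2 * δ), gradNormSq u x) := by gcongr
      _ = _ := by ring
  exact le_of_mul_le_mul_left h3 hδ0

/-! ### Fields depending on time -/

section SpaceTime

variable {E : Type*} [NormedAddCommGroup E] [NormedSpace ℝ E] {f : ℝ → Plane → E} {J : Set ℝ}

theorem uniqueDiffOn_cylinder (hJ : Convex ℝ J) (hJ0 : Ioi 0 ⊆ J) :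
    UniqueDiffOn ℝ (J ×ˢ closedDisk) :=
  (uniqueDiffOn_convex hJ
    ⟨1, mem_interior_iff_mem_nhds.2 (mem_of_superset (Ioi_mem_nhds one_pos) hJ0)⟩).prod
    uniqueDiffOn_closedDisk

theorem cylinder_mem_nhds (hJ0 : Ioi 0 ⊆ J) {z : ℝ × Plane} (hz : z ∈ Ioi (0 : ℝ) ×ˢ disk) :
    J ×ˢ closedDisk ∈ 𝓝 z :=
  prod_mem_nhds (mem_of_superset (Ioi_mem_nhds hz.1) hJ0) (closedDisk_mem_nhds hz.2)

theorem contDiffOn_slice {n : WithTop ℕ∞}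
    (hf : ContDiffOn ℝ n (fun z : ℝ × Plane => f z.1 z.2) (J ×ˢ closedDisk)) {t : ℝ} (ht : t ∈ J) :
    ContDiffOn ℝ n (f t) closedDisk :=
  hf.comp (f := fun x : Plane => (t, x)) (by fun_prop) fun _ hx => ⟨ht, hx⟩

theorem hasFDerivAt_cylinder (hJ0 : Ioi 0 ⊆ J)
    (hf : ContDiffOn ℝ 1 (fun z : ℝ × Plane => f z.1 z.2) (J ×ˢ closedDisk)) {z : ℝ × Plane}
    (hz : z ∈ Ioi (0 : ℝ) ×ˢ disk) :
    HasFDerivAt (fun z : ℝ × Plane => f z.1 z.2)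
      (fderiv ℝ (fun z : ℝ × Plane => f z.1 z.2) z) z :=
  ((hf.contDiffAt (cylinder_mem_nhds hJ0 hz)).differentiableAt one_ne_zero).hasFDerivAt

theorem hasDerivAt_time (hJ0 : Ioi 0 ⊆ J)
    (hf : ContDiffOn ℝ 1 (fun z : ℝ × Plane => f z.1 z.2) (J ×ˢ closedDisk)) {t : ℝ} {x : Plane}
    (ht : 0 < t) (hx : x ∈ disk) :
    HasDerivAt (fun s => f s x) (fderiv ℝ (fun z : ℝ × Plane => f z.1 z.2) (t, x) (1, 0)) t := by
  have h := hasFDerivAt_cylinder hJ0 hf (z := (t, x)) ⟨ht, hx⟩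
  have h1 : HasDerivAt (fun s : ℝ => (s, x)) ((1 : ℝ), (0 : Plane)) t :=
    (hasDerivAt_id t).prodMk (hasDerivAt_const t x)
  exact h.comp_hasDerivAt t h1

theorem hasFDerivAt_space (hJ0 : Ioi 0 ⊆ J)
    (hf : ContDiffOn ℝ 1 (fun z : ℝ × Plane => f z.1 z.2) (J ×ˢ closedDisk)) {t : ℝ} {x : Plane}
    (ht : 0 < t) (hx : x ∈ disk) :
    HasFDerivAt (f t) ((fderiv ℝ (fun z : ℝ × Plane => f z.1 z.2) (t, x)).comp
      (ContinuousLinearMap.inr ℝ ℝ Plane)) x :=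
  (hasFDerivAt_cylinder hJ0 hf (z := (t, x)) ⟨ht, hx⟩).comp x (hasFDerivAt_prodMk_right t x)

theorem extendsTo_timeDeriv (hJ : Convex ℝ J) (hJ0 : Ioi 0 ⊆ J)
    (hf : ContDiffOn ℝ 1 (fun z : ℝ × Plane => f z.1 z.2) (J ×ˢ closedDisk)) :
    ExtendsTo (J ×ˢ closedDisk) (Ioi 0 ×ˢ disk)
      (fun z : ℝ × Plane => deriv (fun s => f s z.2) z.1) :=
  ((ExtendsTo.fderiv hf (uniqueDiffOn_cylinder hJ hJ0)
    fun _ => cylinder_mem_nhds hJ0).clm_apply (.const _)).congr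
    fun _ hz => (hasDerivAt_time hJ0 hf hz.1 hz.2).deriv

theorem extendsTo_spaceDeriv (hJ : Convex ℝ J) (hJ0 : Ioi 0 ⊆ J)
    (hf : ContDiffOn ℝ 1 (fun z : ℝ × Plane => f z.1 z.2) (J ×ˢ closedDisk)) :
    ExtendsTo (J ×ˢ closedDisk) (Ioi 0 ×ˢ disk) (fun z : ℝ × Plane => fderiv ℝ (f z.1) z.2) :=
  (ExtendsTo.comp (φ := fun L : ℝ × Plane →L[ℝ] E => L.comp (ContinuousLinearMap.inr ℝ ℝ Plane))
    (by fun_prop) (ExtendsTo.fderiv hf (uniqueDiffOn_cylinder hJ hJ0)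
      fun _ => cylinder_mem_nhds hJ0)).congr
    fun _ hz => (hasFDerivAt_space hJ0 hf hz.1 hz.2).fderiv

theorem ExtendsTo.slice {H : Type*} [TopologicalSpace H] {F : ℝ × Plane → H} (hJ0 : Ioi 0 ⊆ J)
    (hF : ExtendsTo (J ×ˢ closedDisk) (Ioi 0 ×ˢ disk) F) {t : ℝ} (ht : 0 < t) :
    ExtendsTo closedDisk disk (fun x => F (t, x)) :=
  hF.precomp (φ := fun x : Plane => (t, x)) (by fun_prop) (fun _ hx => ⟨hJ0 ht, hx⟩)
    fun _ hx => ⟨ht, hx⟩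

/-- On a bounded time interval the derivatives of a field that is smooth up to the boundary and the
initial time are bounded. -/
theorem ExtendsTo.exists_bound_Ioc {H : Type*} [NormedAddCommGroup H] {F : ℝ × Plane → H}
    (hF : ExtendsTo (Ici (0 : ℝ) ×ˢ closedDisk) (Ioi 0 ×ˢ disk) F) (T : ℝ) :
    ∃ C, 0 ≤ C ∧ ∀ t ∈ Ioc 0 T, ∀ x ∈ disk, ‖F (t, x)‖ ≤ C := by
  obtain ⟨C, hC0, hC⟩ := (hF.mono (K' := Icc 0 T ×ˢ closedDisk) (U' := Ioc 0 T ×ˢ disk)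
    (prod_mono Icc_subset_Ici_self subset_rfl)
    (prod_mono (fun _ h => h.1) subset_rfl)).exists_bound
    (isCompact_Icc.prod isCompact_closedDisk) (prod_mono Ioc_subset_Icc_self disk_subset)
  exact ⟨C, hC0, fun t ht x hx => hC (t, x) ⟨ht, hx⟩⟩

theorem continuousOn_integral_Icc {F : ℝ × Plane → ℝ} {a b : ℝ}
    (hF : ExtendsTo (Icc a b ×ˢ closedDisk) (Icc a b ×ˢ disk) F) {A : Set Plane}
    (hA : MeasurableSet A) (hAd : A ⊆ disk) :
    ContinuousOn (fun t => ∫ x in A, F (t, x)) (Icc a b) := by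
  obtain ⟨g, hg, hFg⟩ := hF
  obtain ⟨C, hC⟩ := (isCompact_Icc.prod isCompact_closedDisk).exists_bound_of_continuousOn hg
  have hAc := hAd.trans disk_subset
  have hslice : ∀ t ∈ Icc a b, ContinuousOn (fun x => g (t, x)) A := fun t ht =>
    hg.comp (f := fun x : Plane => (t, x)) (by fun_prop) fun x hx => ⟨ht, hAc hx⟩
  have h : ContinuousOn (fun t => ∫ x in A, g (t, x)) (Icc a b) := by
    refine continuousOn_of_dominated (bound := fun _ => C)
      (fun t ht => (hslice t ht).aestronglyMeasurable hA) (fun t ht => ?_) ?_ ?_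
    · exact (ae_restrict_mem hA).mono fun x hx => hC (t, x) ⟨ht, hAc hx⟩
    · exact integrableOn_const
        (hs := ((measure_mono hAd).trans_lt Metric.isBounded_ball.measure_lt_top).ne)
    · exact (ae_restrict_mem hA).mono fun x hx =>
        hg.comp (f := fun t : ℝ => (t, x)) (by fun_prop) fun t ht => ⟨ht, hAc hx⟩
  exact h.congr fun t ht => setIntegral_congr_fun hA fun x hx => hFg ⟨ht, hAd hx⟩

theorem continuousOn_integral_Ioi {F : ℝ × Plane → ℝ}
    (hF : ExtendsTo (Ioi (0 : ℝ) ×ˢ closedDisk) (Ioi 0 ×ˢ disk) F) {A : Set Plane}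
    (hA : MeasurableSet A) (hAd : A ⊆ disk) :
    ContinuousOn (fun t => ∫ x in A, F (t, x)) (Ioi 0) := by
  intro t ht
  have ht0 : 0 < t := ht
  have hsub : Icc (t / 2) (2 * t) ⊆ Ioi 0 := fun s hs => lt_of_lt_of_le (half_pos ht0) hs.1
  have := continuousOn_integral_Icc (hF.mono (prod_mono hsub subset_rfl)
    (prod_mono hsub subset_rfl)) hA hAd
  exact (this.continuousAt (Icc_mem_nhds (by linarith) (by linarith))).continuousWithinAt

/-- Differentiation under the integral over the disk. -/
theorem hasDerivAt_integral_disk {f : ℝ → Plane → ℝ}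
    (hf : ContDiffOn ℝ 1 (fun z : ℝ × Plane => f z.1 z.2) (Ioi 0 ×ˢ closedDisk)) {t : ℝ}
    (ht : 0 < t) :
    HasDerivAt (fun t => ∫ x in disk, f t x)
      (∫ x in disk, deriv (fun s => f s x) t) t := by
  have hde := extendsTo_timeDeriv (convex_Ioi 0) subset_rfl hf
  have hsub : Icc (t / 2) (2 * t) ⊆ Ioi 0 := fun s hs => lt_of_lt_of_le (half_pos ht) hs.1
  obtain ⟨C, -, hC⟩ := (hde.mono (prod_mono hsub subset_rfl)
    (prod_mono hsub subset_rfl)).exists_bound (isCompact_Icc.prod isCompact_closedDisk)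
    (prod_mono subset_rfl disk_subset)
  have hslice : ∀ s > 0, IntegrableOn (f s) disk := fun s hs =>
    ExtendsTo.integrableOn (.of_continuousOn (contDiffOn_slice hf (mem_Ioi.2 hs)).continuousOn)
  refine (hasDerivAt_integral_of_dominated_loc_of_deriv_le (bound := fun _ => C)
    (F' := fun s x => deriv (fun s => f s x) s) (s := Icc (t / 2) (2 * t))
    (Icc_mem_nhds (by linarith) (by linarith)) ?_ (hslice t ht) ?_ ?_ ?_ ?_).2
  · filter_upwards [Ioi_mem_nhds ht] with s hs using (hslice s hs).1
  · exact (hde.slice subset_rfl ht).integrableOn.1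
  · exact (ae_restrict_mem measurableSet_disk).mono fun x hx s hs => hC (s, x) ⟨hs, hx⟩
  · exact integrable_const _
  · exact (ae_restrict_mem measurableSet_disk).mono fun x hx s hs =>
      (hasDerivAt_time subset_rfl hf (hsub hs) hx).differentiableAt.hasDerivAt

end SpaceTime

theorem hasDerivAt_integral_inner {f g : ℝ → Plane → Plane}
    (hf : ContDiffOn ℝ 1 (fun z : ℝ × Plane => f z.1 z.2) (Ioi 0 ×ˢ closedDisk))
    (hg : ContDiffOn ℝ 1 (fun z : ℝ × Plane => g z.1 z.2) (Ioi 0 ×ˢ closedDisk)) {t : ℝ}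
    (ht : 0 < t) :
    HasDerivAt (fun t => ∫ x in disk, inner ℝ (f t x) (g t x))
      ((∫ x in disk, inner ℝ (deriv (fun s => f s x) t) (g t x))
        + ∫ x in disk, inner ℝ (f t x) (deriv (fun s => g s x) t)) t := by
  have hfe : ExtendsTo closedDisk disk (f t) :=
    .of_continuousOn (contDiffOn_slice hf (mem_Ioi.2 ht)).continuousOn
  have hge : ExtendsTo closedDisk disk (g t) :=
    .of_continuousOn (contDiffOn_slice hg (mem_Ioi.2 ht)).continuousOn
  have hfd := (extendsTo_timeDeriv (convex_Ioi 0) subset_rfl hf).slice subset_rfl ht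
  have hgd := (extendsTo_timeDeriv (convex_Ioi 0) subset_rfl hg).slice subset_rfl ht
  have h := hasDerivAt_integral_disk (f := fun t x => inner ℝ (f t x) (g t x))
    (hf.inner ℝ hg) ht
  convert h using 1
  rw [← integral_add (hfd.inner hge).integrableOn (hfe.inner hgd).integrableOn]
  refine setIntegral_congr_fun measurableSet_disk fun x hx => ?_
  have h1 := (hasDerivAt_time subset_rfl hf ht hx).differentiableAt.hasDerivAt
  have h2 := (hasDerivAt_time subset_rfl hg ht hx).differentiableAt.hasDerivAt
  rw [(h1.inner ℝ h2).deriv, add_comm]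

/-! ### Momentum and energy balance -/

/-- The part of the definition of a solution that the Navier--Stokes and the Euler equations share:
smoothness up to the boundary for positive times, the equations, and no flux through the circle. -/
structure IsClassicalSolution (ν : ℝ) (u : ℝ → Plane → Plane) (p : ℝ → Plane → ℝ) : Prop where
  contDiffOn_velocity : ContDiffOn ℝ ∞ (fun z : ℝ × Plane => u z.1 z.2) (Ioi 0 ×ˢ closedDisk)
  contDiffOn_pressure : ContDiffOn ℝ ∞ (fun z : ℝ × Plane => p z.1 z.2) (Ioi 0 ×ˢ closedDisk)
  solvesAt : ∀ t > 0, ∀ x ∈ disk, SolvesAt ν u p t x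
  tangential : ∀ t > 0, ∀ x ∈ circle, inner ℝ (u t x) x = 0

namespace IsClassicalSolution

variable {ν : ℝ} {u : ℝ → Plane → Plane} {p : ℝ → Plane → ℝ}

theorem contDiffOn_one (h : IsClassicalSolution ν u p) :
    ContDiffOn ℝ 1 (fun z : ℝ × Plane => u z.1 z.2) (Ioi 0 ×ˢ closedDisk) :=
  h.contDiffOn_velocity.of_le (by exact_mod_cast le_top)

theorem contDiffOn_at (h : IsClassicalSolution ν u p) {t : ℝ} (ht : 0 < t) :
    ContDiffOn ℝ 1 (u t) closedDisk :=
  contDiffOn_slice h.contDiffOn_one (mem_Ioi.2 ht)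

theorem divergence_eq_zero (h : IsClassicalSolution ν u p) {t : ℝ} (ht : 0 < t) {x : Plane}
    (hx : x ∈ disk) : divergence (u t) x = 0 :=
  (h.solvesAt t ht x hx).2

/-- The momentum equation tested against a divergence-free tangential field. -/
theorem integral_inner_deriv (h : IsClassicalSolution ν u p) {t : ℝ} (ht : 0 < t)
    {φ : Plane → Plane} (hφ : ContDiffOn ℝ 1 φ closedDisk)
    (hdiv : ∀ x ∈ disk, divergence φ x = 0) (hbc : ∀ x ∈ circle, inner ℝ (φ x) x = 0)
    (hνφ : ν = 0 ∨ ∀ x ∈ circle, φ x = 0) :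
    ∫ x in disk, inner ℝ (deriv (fun s => u s x) t) (φ x)
      = (∫ x in disk, inner ℝ (u t x) (fderiv ℝ φ x (u t x)))
        - ν * ∫ x in disk, gradInner (u t) φ x := by
  have hut := h.contDiffOn_at ht
  have hut2 : ContDiffOn ℝ 2 (u t) closedDisk :=
    contDiffOn_slice (h.contDiffOn_velocity.of_le
      (WithTop.coe_le_coe.2 (le_top : (2 : ℕ∞) ≤ ⊤))) (mem_Ioi.2 ht)
  have hpt : ContDiffOn ℝ 1 (p t) closedDisk :=
    contDiffOn_slice (h.contDiffOn_pressure.of_le (by exact_mod_cast le_top)) (mem_Ioi.2 ht)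
  have hue : ExtendsTo closedDisk disk (u t) := .of_continuousOn hut.continuousOn
  have hφe : ExtendsTo closedDisk disk φ := .of_continuousOn hφ.continuousOn
  have i1 : IntegrableOn (fun x => inner ℝ (fderiv ℝ (u t) x (u t x)) (φ x)) disk :=
    (((extendsTo_fderiv hut).clm_apply hue).inner hφe).integrableOn
  have i2 : IntegrableOn (fun x => inner ℝ (gradient (p t) x) (φ x)) disk := by
    simp only [inner_gradient_left]
    exact ((extendsTo_fderiv hpt).clm_apply hφe).integrableOn
  have i3 : IntegrableOn (fun x => inner ℝ (Laplacian.laplacian (u t) x) (φ x)) disk :=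
    ((extendsTo_laplacian hut2).inner hφe).integrableOn
  have i31 : IntegrableOn (fun x => ν * inner ℝ (Laplacian.laplacian (u t) x) (φ x)
      - inner ℝ (fderiv ℝ (u t) x (u t x)) (φ x)) disk := (i3.const_mul ν).sub i1
  have heq : ∀ x ∈ disk, inner ℝ (deriv (fun s => u s x) t) (φ x)
      = ν * inner ℝ (Laplacian.laplacian (u t) x) (φ x)
        - inner ℝ (fderiv ℝ (u t) x (u t x)) (φ x) - inner ℝ (gradient (p t) x) (φ x) := by
    intro x hx
    rw [eq_sub_of_add_eq (h.solvesAt t ht x hx).1]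
    simp only [inner_sub_left, inner_add_left, inner_neg_left, inner_smul_left, conj_trivial]
    ring
  have hvisc : ν * ∫ x in disk, inner ℝ (Laplacian.laplacian (u t) x) (φ x)
      = -(ν * ∫ x in disk, gradInner (u t) φ x) := by
    rcases hνφ with h0 | h0
    · simp [h0]
    · rw [integral_inner_laplacian hut2 hφ h0, mul_neg]
  have hconv := integral_inner_convection hut (fun x hx => h.divergence_eq_zero ht hx)
    (h.tangential t ht) hut hφ
  rw [setIntegral_congr_fun measurableSet_disk heq, integral_sub i31 i2,
    integral_sub (i3.const_mul ν) i1, integral_const_mul, hvisc, hconv,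
    integral_inner_gradient_eq_zero hφ hdiv hbc hpt]
  ring

/-- The energy balance. Without viscosity the no-slip condition is not needed. -/
theorem hasDerivAt_energy (h : IsClassicalSolution ν u p)
    (h0 : ν = 0 ∨ ∀ t > 0, ∀ x ∈ circle, u t x = 0) {t : ℝ} (ht : 0 < t) :
    HasDerivAt (fun t => ∫ x in disk, ‖u t x‖ ^ 2)
      (-(2 * ν * ∫ x in disk, gradNormSq (u t) x)) t := by
  have hd := hasDerivAt_integral_inner h.contDiffOn_one h.contDiffOn_one ht
  have hdiv : ∀ x ∈ disk, divergence (u t) x = 0 := fun x hx => h.divergence_eq_zero ht hx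
  have hm := h.integral_inner_deriv ht (h.contDiffOn_at ht) hdiv (h.tangential t ht)
    (h0.imp_right fun h0 => h0 t ht)
  rw [integral_inner_convection_self (h.contDiffOn_at ht) hdiv (h.tangential t ht)
    (h.contDiffOn_at ht)] at hm
  simp only [gradInner_self] at hm
  have hc : ∫ x in disk, inner ℝ (u t x) (deriv (fun s => u s x) t)
      = ∫ x in disk, inner ℝ (deriv (fun s => u s x) t) (u t x) := by
    simp only [real_inner_comm]
  simp only [hc, hm, real_inner_self_eq_norm_sq] at hd
  convert hd using 1
  ring

theorem extendsTo_gradNormSq (h : IsClassicalSolution ν u p) :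
    ExtendsTo (Ioi (0 : ℝ) ×ˢ closedDisk) (Ioi 0 ×ˢ disk)
      (fun z : ℝ × Plane => gradNormSq (u z.1) z.2) :=
  ExtendsTo.sum _ fun _ => ((extendsTo_spaceDeriv (convex_Ioi 0) subset_rfl
    h.contDiffOn_one).clm_apply (.const _)).norm_sq

theorem continuousOn_dissipation (h : IsClassicalSolution ν u p) {A : Set Plane}
    (hA : MeasurableSet A) (hAd : A ⊆ disk) :
    ContinuousOn (fun t => ∫ x in A, gradNormSq (u t) x) (Ioi 0) :=
  continuousOn_integral_Ioi h.extendsTo_gradNormSq hA hAd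

theorem integrableOn_gradNormSq (h : IsClassicalSolution ν u p) {t : ℝ} (ht : 0 < t) :
    IntegrableOn (gradNormSq (u t)) disk :=
  (KatoCriterion.extendsTo_gradNormSq (h.contDiffOn_at ht)).integrableOn

theorem energy_sub_energy (h : IsClassicalSolution ν u p)
    (h0 : ∀ t > 0, ∀ x ∈ circle, u t x = 0) {s t : ℝ} (hs : 0 < s) (hst : s ≤ t) :
    (∫ x in disk, ‖u s x‖ ^ 2) - ∫ x in disk, ‖u t x‖ ^ 2
      = 2 * ν * ∫ τ in s..t, ∫ x in disk, gradNormSq (u τ) x := by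
  have hsub : uIcc s t ⊆ Ioi 0 := by
    rw [uIcc_of_le hst]; exact fun τ hτ => hs.trans_le hτ.1
  have hc := (h.continuousOn_dissipation measurableSet_disk subset_rfl).mono hsub
  have := intervalIntegral.integral_eq_sub_of_hasDerivAt
    (fun τ hτ => h.hasDerivAt_energy (.inr h0) (hsub hτ))
    (hc.const_smul (2 * ν)).neg.intervalIntegrable
  rw [intervalIntegral.integral_neg, intervalIntegral.integral_const_mul] at this
  linarith

theorem energy_eq_of_inviscid (h : IsClassicalSolution 0 u p)
    (hu : ContinuousOn (fun z : ℝ × Plane => u z.1 z.2) (Ici 0 ×ˢ closedDisk)) {t : ℝ}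
    (ht : 0 < t) :
    ∫ x in disk, ‖u t x‖ ^ 2 = ∫ x in disk, ‖u 0 x‖ ^ 2 := by
  have hc : ContinuousOn (fun t => ∫ x in disk, ‖u t x‖ ^ 2) (Icc 0 t) :=
    continuousOn_integral_Icc (F := fun z => ‖u z.1 z.2‖ ^ 2)
      (.of_continuousOn ((hu.mono (prod_mono Icc_subset_Ici_self subset_rfl)).norm.pow 2))
      measurableSet_disk subset_rfl
  obtain ⟨c, hc, hc'⟩ := exists_hasDerivAt_eq_slope _ _ ht hc
    fun s hs => h.hasDerivAt_energy (.inl rfl) hs.1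
  rw [mul_zero, zero_mul, neg_zero, eq_comm, div_eq_zero_iff] at hc'
  rcases hc' with h1 | h1 <;> linarith

end IsClassicalSolution

/-! ### Mean square norms -/

theorem eLpNorm_two_eq {f : Plane → Plane} (hf : ExtendsTo closedDisk disk f) :
    eLpNorm f 2 (volume.restrict disk) = ENNReal.ofReal (√(∫ x in disk, ‖f x‖ ^ 2)) := by
  have hm : AEStronglyMeasurable f (volume.restrict disk) := hf.integrableOn.1
  have hLp : MemLp f 2 (volume.restrict disk) :=
    (memLp_two_iff_integrable_sq_norm hm).2 hf.norm_sq.integrableOn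
  rw [hLp.eLpNorm_eq_integral_rpow_norm (by norm_num) (by norm_num), Real.sqrt_eq_rpow]
  simp

/-- A solution that attains its initial velocity in mean square never exceeds the initial
energy. -/
theorem IsClassicalSolution.energy_le {ν : ℝ} {u : ℝ → Plane → Plane} {p : ℝ → Plane → ℝ}
    (h : IsClassicalSolution ν u p) (hν : 0 ≤ ν) (h0 : ∀ t > 0, ∀ x ∈ circle, u t x = 0)
    {v : Plane → Plane} (hv : ContinuousOn v closedDisk)
    (hlim : Tendsto (fun t => eLpNorm (u t - v) 2 (volume.restrict disk)) (𝓝[>] 0) (𝓝 0))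
    {t : ℝ} (ht : 0 < t) :
    ∫ x in disk, ‖u t x‖ ^ 2 ≤ ∫ x in disk, ‖v x‖ ^ 2 := by
  have hve : ExtendsTo closedDisk disk v := .of_continuousOn hv
  have hue : ∀ s > 0, ExtendsTo closedDisk disk (u s) := fun s hs =>
    .of_continuousOn (h.contDiffOn_at hs).continuousOn
  have hle : ∀ s ∈ Ioc 0 t, eLpNorm (u t) 2 (volume.restrict disk)
      ≤ eLpNorm (u s - v) 2 (volume.restrict disk) + eLpNorm v 2 (volume.restrict disk) := by
    intro s hs
    have h1 : ∫ x in disk, ‖u t x‖ ^ 2 ≤ ∫ x in disk, ‖u s x‖ ^ 2 := by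
      have h2 := h.energy_sub_energy h0 hs.1 hs.2
      have h3 : 0 ≤ ∫ τ in s..t, ∫ x in disk, gradNormSq (u τ) x :=
        intervalIntegral.integral_nonneg hs.2 fun τ _ =>
          integral_nonneg fun x => gradNormSq_nonneg _ _
      have h4 : 0 ≤ 2 * ν * ∫ τ in s..t, ∫ x in disk, gradNormSq (u τ) x := by positivity
      linarith
    calc eLpNorm (u t) 2 (volume.restrict disk) ≤ eLpNorm (u s) 2 (volume.restrict disk) := by
          rw [eLpNorm_two_eq (hue t ht), eLpNorm_two_eq (hue s hs.1)]
          gcongr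
      _ = eLpNorm (u s - v + v) 2 (volume.restrict disk) := by rw [sub_add_cancel]
      _ ≤ _ := eLpNorm_add_le ((hue s hs.1).sub hve).integrableOn.1 hve.integrableOn.1
          (by norm_num)
  have hlim2 := hlim.add_const (eLpNorm v 2 (volume.restrict disk))
  rw [zero_add] at hlim2
  have h5 := ge_of_tendsto hlim2 (by filter_upwards [Ioc_mem_nhdsGT ht] with s hs using hle s hs)
  rw [eLpNorm_two_eq (hue t ht), eLpNorm_two_eq hve,
    ENNReal.ofReal_le_ofReal_iff (Real.sqrt_nonneg _)] at h5
  exact (Real.sqrt_le_sqrt_iff (integral_nonneg fun x => sq_nonneg _)).1 h5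

/-! ### The boundary layer corrector -/

/-- A bump function on the line that is `1` near `0` and vanishes outside `(-1/2, 1/2)`. -/
def profileBump : ContDiffBump (0 : ℝ) := ⟨1 / 4, 1 / 2, by norm_num, by norm_num⟩

/-- The profile `s ↦ s χ(s)` of the boundary layer, with `χ` a bump function. -/
def profile (s : ℝ) : ℝ := s * profileBump s

theorem contDiff_profile {n : ℕ∞} : ContDiff ℝ n profile :=
  contDiff_id.mul profileBump.contDiff

theorem profile_zero : profile 0 = 0 := by simp [profile]

theorem deriv_profile_zero : deriv profile 0 = 1 := by
  have h : profile =ᶠ[𝓝 0] fun s => s := by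
    filter_upwards [profileBump.eventuallyEq_one] with s hs
    simp [profile, hs]
  rw [h.deriv_eq, deriv_id'']

theorem profile_eq_zero {s : ℝ} (hs : 1 / 2 ≤ |s|) : profile s = 0 := by
  have : profileBump s = 0 := profileBump.zero_of_le_dist (by simpa [profileBump] using hs)
  simp [profile, this]

theorem profile_eventuallyEq_zero {s : ℝ} (hs : 1 / 2 < s) : profile =ᶠ[𝓝 s] fun _ => 0 := by
  filter_upwards [Ioi_mem_nhds hs] with r hr
  exact profile_eq_zero ((le_of_lt hr).trans (le_abs_self r))

theorem contDiff_deriv_profile : ContDiff ℝ 1 (deriv profile) :=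
  ((contDiff_succ_iff_deriv (n := 1)).1 (contDiff_profile (n := 2))).2.2

theorem exists_bound_profile :
    ∃ C, 0 ≤ C ∧ ∀ s, |profile s| ≤ C ∧ |deriv profile s| ≤ C ∧ |deriv (deriv profile) s| ≤ C := by
  have h0 : HasCompactSupport profile :=
    HasCompactSupport.intro (isCompact_Icc (a := (-1 : ℝ)) (b := 1)) fun s hs => by
      refine profile_eq_zero (not_lt.1 fun h => hs ?_)
      rw [abs_lt] at h
      exact ⟨by linarith, by linarith⟩
  obtain ⟨C0, h1⟩ := h0.exists_bound_of_continuous (contDiff_profile (n := 0)).continuous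
  obtain ⟨C1, h2⟩ := h0.deriv.exists_bound_of_continuous contDiff_deriv_profile.continuous
  obtain ⟨C2, h3⟩ := h0.deriv.deriv.exists_bound_of_continuous
    (contDiff_deriv_profile.continuous_deriv le_rfl)
  refine ⟨max C0 (max C1 C2), (norm_nonneg _).trans ((h1 0).trans (le_max_left _ _)), fun s =>
    ⟨(h1 s).trans (le_max_left _ _), (h2 s).trans ?_, (h3 s).trans ?_⟩⟩
  · exact (le_max_left _ _).trans (le_max_right _ _)
  · exact (le_max_right _ _).trans (le_max_right _ _)

/-- The rotated gradient `(-∂₂f, ∂₁f)` as a function of the differential `df`. -/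
def perpDual : (Plane →L[ℝ] ℝ) →L[ℝ] Plane :=
  (ContinuousLinearMap.apply ℝ ℝ (basisVec 0)).smulRight (basisVec 1)
    - (ContinuousLinearMap.apply ℝ ℝ (basisVec 1)).smulRight (basisVec 0)

theorem perpDual_apply_zero (L : Plane →L[ℝ] ℝ) : perpDual L 0 = -L (basisVec 1) := by
  simp [perpDual]

theorem perpDual_apply_one (L : Plane →L[ℝ] ℝ) : perpDual L 1 = L (basisVec 0) := by
  simp [perpDual]

theorem perp_eq_perpDual (x : Plane) : perp x = perpDual (innerSL ℝ x) := by
  ext i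
  fin_cases i
  · simp [perp, perpDual_apply_zero, inner_basisVec]
  · simp [perp, perpDual_apply_one, inner_basisVec]

theorem contDiff_perp {n : WithTop ℕ∞} : ContDiff ℝ n perp := by
  have : perp = fun x => perpDual (innerSL ℝ x) := funext perp_eq_perpDual
  rw [this]
  exact perpDual.contDiff.comp (innerSL ℝ).contDiff

/-- A rotated gradient is divergence-free. -/
theorem divergence_perpDual_fderiv {f : Plane → ℝ} {x : Plane} (hf : ContDiffAt ℝ 2 f x) :
    divergence (fun y => perpDual (fderiv ℝ f y)) x = 0 := by
  have hd : DifferentiableAt ℝ (fderiv ℝ f) x :=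
    (hf.fderiv_right (m := 1) (by norm_num)).differentiableAt one_ne_zero
  have h1 : fderiv ℝ (fun y => perpDual (fderiv ℝ f y)) x
      = perpDual.comp (fderiv ℝ (fderiv ℝ f) x) :=
    (perpDual.hasFDerivAt.comp x hd.hasFDerivAt).fderiv
  have h2 : IsSymmSndFDerivAt ℝ f x := hf.isSymmSndFDerivAt (by simp)
  simp only [divergence, partialDeriv, h1, Fin.sum_univ_two]
  simp only [ContinuousLinearMap.comp_apply, perpDual_apply_zero, perpDual_apply_one]
  rw [h2.eq (basisVec 0) (basisVec 1)]
  ring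

/-- A tangential vector on the circle is recovered from its angular component. -/
theorem inner_perp_smul_perp {x w : Plane} (hx : x ∈ circle) (hw : inner ℝ w x = 0) :
    inner ℝ w (perp x) • perp x = w := by
  have h1 : x 0 ^ 2 + x 1 ^ 2 = 1 := by
    have := mem_circle.1 hx
    have h := EuclideanSpace.norm_sq_eq x
    rw [this] at h
    simpa [Fin.sum_univ_two] using h.symm
  rw [inner_eq_sum, Fin.sum_univ_two] at hw
  ext i
  fin_cases i
  · simp [inner_eq_sum, perp]
    linear_combination w 0 * h1 - x 0 * hw
  · simp [inner_eq_sum, perp]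
    linear_combination w 1 * h1 - x 1 * hw

/-- The corrector with components `P` and `Q`: for `P = (u · x^⊥) x^⊥` and
`Q = -½ ∇^⊥(u · x^⊥)` it is the rotated gradient of
`-½ δ κ((1 - |x|²) / δ) (u · x^⊥)`, with `κ` the profile. -/
def corrector (P Q : ℝ → Plane → Plane) (δ : ℝ) (t : ℝ) (x : Plane) : Plane :=
  deriv profile ((1 - ‖x‖ ^ 2) / δ) • P t x + (δ * profile ((1 - ‖x‖ ^ 2) / δ)) • Q t x

section Corrector

variable {P Q : ℝ → Plane → Plane} {J : Set ℝ}

theorem contDiffOn_corrector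
    (hP : ContDiffOn ℝ 1 (fun z : ℝ × Plane => P z.1 z.2) (J ×ˢ closedDisk))
    (hQ : ContDiffOn ℝ 1 (fun z : ℝ × Plane => Q z.1 z.2) (J ×ˢ closedDisk)) (δ : ℝ) :
    ContDiffOn ℝ 1 (fun z : ℝ × Plane => corrector P Q δ z.1 z.2) (J ×ˢ closedDisk) := by
  have hm : ContDiff ℝ 1 fun z : ℝ × Plane => (1 - ‖z.2‖ ^ 2) / δ :=
    (contDiff_depth.comp contDiff_snd).div_const δ
  exact ((contDiff_deriv_profile.comp hm).contDiffOn.smul hP).add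
    ((contDiff_const.mul ((contDiff_profile (n := 1)).comp hm)).contDiffOn.smul hQ)

theorem corrector_of_circle (δ t : ℝ) {x : Plane} (hx : x ∈ circle) :
    corrector P Q δ t x = P t x := by
  simp [corrector, mem_circle.1 hx, profile_zero, deriv_profile_zero]

theorem corrector_eventuallyEq_zero {δ : ℝ} (hδ : 0 < δ) {x : Plane} (hx : x ∈ disk)
    (hxl : x ∉ layer δ) : ∀ᶠ y in 𝓝 x, ∀ t, corrector P Q δ t y = 0 := by
  have h1 : ¬ (1 - ‖x‖ ^ 2 < δ) := fun h => hxl ⟨hx, h⟩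
  have h2 : 1 / 2 < (1 - ‖x‖ ^ 2) / δ := by
    rw [lt_div_iff₀ hδ]; linarith
  have hc : ContinuousAt (fun y : Plane => (1 - ‖y‖ ^ 2) / δ) x := by fun_prop
  filter_upwards [hc.eventually (lt_mem_nhds h2)] with y hy t
  have h3 := profile_eventuallyEq_zero hy
  rw [corrector, h3.deriv_eq, h3.eq_of_nhds]
  simp

theorem hasDerivAt_corrector {δ t : ℝ} {x P' Q' : Plane}
    (hP : HasDerivAt (fun s => P s x) P' t) (hQ : HasDerivAt (fun s => Q s x) Q' t) :
    HasDerivAt (fun s => corrector P Q δ s x)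
      (deriv profile ((1 - ‖x‖ ^ 2) / δ) • P' + (δ * profile ((1 - ‖x‖ ^ 2) / δ)) • Q') t :=
  (hP.fun_const_smul _).fun_add (hQ.fun_const_smul _)

theorem norm_fderiv_corrector_le {δ t C M : ℝ} (hδ0 : 0 < δ) (hδ1 : δ ≤ 1) (hC : 0 ≤ C)
    (hM : 0 ≤ M) (hprof : ∀ s, |profile s| ≤ C ∧ |deriv profile s| ≤ C ∧
      |deriv (deriv profile) s| ≤ C) {x : Plane} (hx : x ∈ disk)
    (hP : DifferentiableAt ℝ (P t) x) (hQ : DifferentiableAt ℝ (Q t) x)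
    (hPM : ‖P t x‖ ≤ M) (hQM : ‖Q t x‖ ≤ M) (hDP : ‖fderiv ℝ (P t) x‖ ≤ M)
    (hDQ : ‖fderiv ℝ (Q t) x‖ ≤ M) :
    ‖fderiv ℝ (corrector P Q δ t) x‖ ≤ 6 * C * M / δ := by
  set s := (1 - ‖x‖ ^ 2) / δ with hs
  have hA := hasFDerivAt_comp_depth (x := x) (δ := δ)
    ((contDiff_deriv_profile.differentiable one_ne_zero) ((1 - ‖x‖ ^ 2) / δ))
  have hB := hasFDerivAt_comp_depth (x := x) (δ := δ)
    (((contDiff_profile (n := 1)).differentiable one_ne_zero) ((1 - ‖x‖ ^ 2) / δ))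
  have hv : HasFDerivAt (corrector P Q δ t) _ x :=
    (hA.smul hP.hasFDerivAt).add ((hB.const_mul δ).smul hQ.hasFDerivAt)
  rw [hv.fderiv, ← hs]
  obtain ⟨h0, h1, h2⟩ := hprof s
  have hx1 : ‖x‖ ≤ 1 := (mem_disk.1 hx).le
  have n1 : ‖deriv profile s • fderiv ℝ (P t) x‖ ≤ C * M := by
    rw [norm_smul, Real.norm_eq_abs]; gcongr
  have n2 : ‖(-(2 * deriv (deriv profile) s / δ) • innerSL ℝ x).smulRight (P t x)‖
      ≤ 2 * C / δ * M := by
    rw [ContinuousLinearMap.norm_smulRight_apply, norm_smul, innerSL_apply_norm, norm_neg,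
      Real.norm_eq_abs, abs_div, abs_mul, abs_two, abs_of_pos hδ0]
    calc 2 * |deriv (deriv profile) s| / δ * ‖x‖ * ‖P t x‖ ≤ 2 * C / δ * 1 * M := by gcongr
      _ = _ := by ring
  have n3 : ‖(δ * profile s) • fderiv ℝ (Q t) x‖ ≤ 1 * C * M := by
    rw [norm_smul, Real.norm_eq_abs, abs_mul, abs_of_pos hδ0]; gcongr
  have n4 : ‖(δ • (-(2 * deriv profile s / δ) • innerSL ℝ x)).smulRight (Q t x)‖
      ≤ 2 * C * M := by
    rw [ContinuousLinearMap.norm_smulRight_apply, norm_smul, norm_smul, innerSL_apply_norm,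
      norm_neg, Real.norm_eq_abs, Real.norm_eq_abs, abs_div, abs_mul, abs_two, abs_of_pos hδ0]
    calc δ * (2 * |deriv profile s| / δ * ‖x‖) * ‖Q t x‖
        = 2 * |deriv profile s| * ‖x‖ * ‖Q t x‖ := by field_simp
      _ ≤ 2 * C * 1 * M := by gcongr
      _ = _ := by ring
  have hCM : C * M ≤ C * M / δ := by
    rw [le_div_iff₀ hδ0]
    exact mul_le_of_le_one_right (by positivity) hδ1
  calc _ ≤ (C * M + 2 * C / δ * M) + (1 * C * M + 2 * C * M) :=
        (norm_add_le _ _).trans (add_le_add ((norm_add_le _ _).trans (add_le_add n1 n2))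
          ((norm_add_le _ _).trans (add_le_add n3 n4)))
    _ = 4 * (C * M) + 2 * (C * M / δ) := by ring
    _ ≤ 4 * (C * M / δ) + 2 * (C * M / δ) := by linarith
    _ = 6 * C * M / δ := by ring

end Corrector

/-- Kato's corrector: a divergence-free field that agrees with `u` on the circle and lives in the
layer of width `δ`, with bounds that are uniform in `δ`. -/
theorem exists_corrector {u : ℝ → Plane → Plane}
    (hu : ContDiffOn ℝ ∞ (fun z : ℝ × Plane => u z.1 z.2) (Ici 0 ×ˢ closedDisk))
    (hbc : ∀ t > 0, ∀ x ∈ circle, inner ℝ (u t x) x = 0) (T : ℝ) :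
    ∃ K, 0 ≤ K ∧ ∀ δ, 0 < δ → δ ≤ 1 → ∃ v : ℝ → Plane → Plane,
      ContDiffOn ℝ 1 (fun z : ℝ × Plane => v z.1 z.2) (Ici 0 ×ˢ closedDisk) ∧
      (∀ t > 0, ∀ x ∈ disk, divergence (v t) x = 0) ∧
      (∀ t > 0, ∀ x ∈ circle, v t x = u t x) ∧
      (∀ t, ∀ x ∈ disk, x ∉ layer δ →
        v t x = 0 ∧ deriv (fun s => v s x) t = 0 ∧ fderiv ℝ (v t) x = 0) ∧
      ∀ t ∈ Ioc 0 T, ∀ x ∈ disk,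
        ‖v t x‖ ≤ K ∧ ‖deriv (fun s => v s x) t‖ ≤ K ∧ ‖fderiv ℝ (v t) x‖ ≤ K / δ := by
  have hJ : Ioi (0 : ℝ) ⊆ Ici 0 := Ioi_subset_Ici_self
  set G : ℝ → Plane → ℝ := fun t x => inner ℝ (u t x) (perp x) with hG
  have hGs : ContDiffOn ℝ ∞ (fun z : ℝ × Plane => G z.1 z.2) (Ici 0 ×ˢ closedDisk) :=
    hu.inner ℝ (contDiff_perp.comp contDiff_snd).contDiffOn
  have hGs1 : ContDiffOn ℝ 1 (fun z : ℝ × Plane => G z.1 z.2) (Ici 0 ×ˢ closedDisk) :=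
    hGs.of_le (by exact_mod_cast le_top)
  set DG : ℝ × Plane → Plane →L[ℝ] ℝ := fun z =>
    (fderivWithin ℝ (fun z : ℝ × Plane => G z.1 z.2) (Ici 0 ×ˢ closedDisk) z).comp
      (ContinuousLinearMap.inr ℝ ℝ Plane) with hDG
  have hDGs : ContDiffOn ℝ 1 DG (Ici 0 ×ˢ closedDisk) :=
    (hGs.fderivWithin (m := 1) (uniqueDiffOn_cylinder (convex_Ici 0) hJ)
      (WithTop.coe_le_coe.2 (le_top : (2 : ℕ∞) ≤ ⊤))).clm_comp contDiffOn_const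
  set P : ℝ → Plane → Plane := fun t x => G t x • perp x with hP
  set Q : ℝ → Plane → Plane := fun t x => (-(1 / 2) : ℝ) • perpDual (DG (t, x)) with hQ
  have hPs : ContDiffOn ℝ 1 (fun z : ℝ × Plane => P z.1 z.2) (Ici 0 ×ˢ closedDisk) :=
    hGs1.smul (contDiff_perp.comp contDiff_snd).contDiffOn
  have hQs : ContDiffOn ℝ 1 (fun z : ℝ × Plane => Q z.1 z.2) (Ici 0 ×ˢ closedDisk) :=
    (perpDual.contDiff.comp_contDiffOn hDGs).const_smul _
  obtain ⟨C, hC0, hC⟩ := exists_bound_profile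
  have bound : ∀ f : ℝ → Plane → Plane,
      ContDiffOn ℝ 1 (fun z : ℝ × Plane => f z.1 z.2) (Ici 0 ×ˢ closedDisk) →
      ∃ M, 0 ≤ M ∧ ∀ t ∈ Ioc 0 T, ∀ x ∈ disk,
        ‖f t x‖ ≤ M ∧ ‖deriv (fun s => f s x) t‖ ≤ M ∧ ‖fderiv ℝ (f t) x‖ ≤ M := by
    intro f hf
    obtain ⟨A, hA0, hA⟩ := (ExtendsTo.of_continuousOn hf.continuousOn).exists_bound_Ioc T
    obtain ⟨B, hB0, hB⟩ := (extendsTo_timeDeriv (convex_Ici 0) hJ hf).exists_bound_Ioc T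
    obtain ⟨D, hD0, hD⟩ := (extendsTo_spaceDeriv (convex_Ici 0) hJ hf).exists_bound_Ioc T
    refine ⟨A + B + D, by positivity, fun t ht x hx => ⟨?_, ?_, ?_⟩⟩
    · linarith [hA t ht x hx]
    · linarith [hB t ht x hx]
    · linarith [hD t ht x hx]
  obtain ⟨M₁, hM₁, hPb⟩ := bound P hPs
  obtain ⟨M₂, hM₂, hQb⟩ := bound Q hQs
  set M := M₁ + M₂ with hM
  have hM0 : 0 ≤ M := by positivity
  refine ⟨6 * C * M, by positivity, fun δ hδ0 hδ1 => ⟨corrector P Q δ,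
    contDiffOn_corrector hPs hQs δ, ?_, ?_, ?_, ?_⟩⟩
  · intro t ht x hx
    -- In the open disk the corrector is the rotated gradient of its stream function.
    set ψ : Plane → ℝ := fun y => -(δ / 2) * (profile ((1 - ‖y‖ ^ 2) / δ) * G t y) with hψ
    have hGt : ContDiffOn ℝ ∞ (G t) closedDisk := contDiffOn_slice hGs (hJ ht)
    have hψs : ContDiffAt ℝ 2 ψ x := by
      refine contDiffAt_const.mul (ContDiffAt.mul ?_ ?_)
      · exact ((contDiff_profile (n := 2)).comp (contDiff_depth.div_const δ)).contDiffAt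
      · exact (hGt.contDiffAt (closedDisk_mem_nhds hx)).of_le
          (WithTop.coe_le_coe.2 (le_top : (2 : ℕ∞) ≤ ⊤))
    have heq : corrector P Q δ t =ᶠ[𝓝 x] fun y => perpDual (fderiv ℝ ψ y) := by
      filter_upwards [isOpen_disk.mem_nhds hx] with y hy
      have h1 := hasFDerivAt_comp_depth (x := y) (δ := δ)
        (((contDiff_profile (n := 1)).differentiable one_ne_zero) ((1 - ‖y‖ ^ 2) / δ))
      have h2 : HasFDerivAt (G t) (DG (t, y)) y := by
        have := hasFDerivAt_space hJ hGs1 ht hy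
        rwa [← fderivWithin_of_mem_nhds (cylinder_mem_nhds hJ (z := (t, y)) ⟨ht, hy⟩)] at this
      have h3 : HasFDerivAt ψ _ y := (h1.mul h2).const_mul (-(δ / 2))
      rw [h3.fderiv]
      simp only [map_smul, map_add, ← perp_eq_perpDual, corrector, hP, hQ, smul_add, smul_smul]
      rw [add_comm]
      congr 2
      · ring
      · field_simp
    have h4 : divergence (corrector P Q δ t) x
        = divergence (fun y => perpDual (fderiv ℝ ψ y)) x := by
      simp only [divergence, partialDeriv, heq.fderiv_eq]
    rw [h4, divergence_perpDual_fderiv hψs]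
  · intro t ht x hx
    rw [corrector_of_circle δ t hx]
    exact inner_perp_smul_perp hx (hbc t ht x hx)
  · intro t x hx hxl
    have hz := corrector_eventuallyEq_zero (P := P) (Q := Q) hδ0 hx hxl
    have hzx := hz.self_of_nhds
    refine ⟨hzx t, ?_, ?_⟩
    · simp only [hzx, deriv_const]
    · have : corrector P Q δ t =ᶠ[𝓝 x] fun _ => 0 := hz.mono fun y hy => hy t
      rw [this.fderiv_eq, fderiv_fun_const]
      rfl
  · intro t ht x hx
    obtain ⟨p1, p2, p3⟩ := hPb t ht x hx
    obtain ⟨q1, q2, q3⟩ := hQb t ht x hx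
    have comb : ∀ a b : Plane, ‖a‖ ≤ M → ‖b‖ ≤ M →
        ‖deriv profile ((1 - ‖x‖ ^ 2) / δ) • a + (δ * profile ((1 - ‖x‖ ^ 2) / δ)) • b‖
          ≤ 6 * C * M := by
      intro a b ha hb
      obtain ⟨h0, h1, -⟩ := hC ((1 - ‖x‖ ^ 2) / δ)
      have e1 : ‖deriv profile ((1 - ‖x‖ ^ 2) / δ) • a‖ ≤ C * M := by
        rw [norm_smul, Real.norm_eq_abs]; gcongr
      have e2 : ‖(δ * profile ((1 - ‖x‖ ^ 2) / δ)) • b‖ ≤ 1 * C * M := by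
        rw [norm_smul, Real.norm_eq_abs, abs_mul, abs_of_pos hδ0]; gcongr
      have : 0 ≤ C * M := by positivity
      linarith [norm_add_le (deriv profile ((1 - ‖x‖ ^ 2) / δ) • a)
        ((δ * profile ((1 - ‖x‖ ^ 2) / δ)) • b)]
    refine ⟨comb _ _ (by linarith) (by linarith), ?_, ?_⟩
    · rw [(hasDerivAt_corrector (hasDerivAt_time hJ hPs ht.1 hx).differentiableAt.hasDerivAt
        (hasDerivAt_time hJ hQs ht.1 hx).differentiableAt.hasDerivAt).deriv]
      exact comb _ _ (by linarith) (by linarith)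
    · exact norm_fderiv_corrector_le hδ0 hδ1 hC0 hM0 hC hx
        (hasFDerivAt_space hJ hPs ht.1 hx).differentiableAt
        (hasFDerivAt_space hJ hQs ht.1 hx).differentiableAt
        (by linarith) (by linarith) (by linarith) (by linarith)

/-! ### Convergence implies vanishing dissipation -/

theorem lintegral_Ioo_le_of_forall_Ioc {T : ℝ} {h : ℝ → ℝ≥0∞} {B : ℝ≥0∞} (hT : 0 < T)
    (hm : AEMeasurable h (volume.restrict (Ioo 0 T)))
    (hB : ∀ s t, 0 < s → s ≤ t → t < T → ∫⁻ τ in Ioc s t, h τ ≤ B) :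
    ∫⁻ τ in Ioo 0 T, h τ ≤ B := by
  have hcov : AECover (volume.restrict (Ioo 0 T)) (𝓝[>] (0 : ℝ))
      fun ε => Ioc (0 + ε) (T - ε) := by
    refine aecover_Ioo_of_Ioc ?_ ?_
    · exact (Continuous.tendsto' (by fun_prop) _ _ (by simp)).mono_left nhdsWithin_le_nhds
    · exact (Continuous.tendsto' (by fun_prop) _ _ (by simp)).mono_left nhdsWithin_le_nhds
  refine le_of_tendsto (hcov.lintegral_tendsto_of_countably_generated hm) ?_
  filter_upwards [Ioo_mem_nhdsGT (half_pos hT)] with ε hε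
  have hsub : Ioc (0 + ε) (T - ε) ⊆ Ioo 0 T := fun τ hτ =>
    ⟨by linarith [hτ.1, hε.1], by linarith [hτ.2, hε.1]⟩
  rw [Measure.restrict_restrict measurableSet_Ioc, inter_eq_self_of_subset_left hsub]
  exact hB _ _ (by linarith [hε.1]) (by linarith [hε.2]) (by linarith [hε.1])

theorem ofReal_intervalIntegral {h : ℝ → ℝ} (hc : ContinuousOn h (Ioi 0)) (h0 : ∀ τ, 0 ≤ h τ)
    {s t : ℝ} (hs : 0 < s) (hst : s ≤ t) :
    ENNReal.ofReal (∫ τ in s..t, h τ) = ∫⁻ τ in Ioc s t, ENNReal.ofReal (h τ) := by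
  rw [intervalIntegral.integral_of_le hst, ofReal_integral_eq_lintegral_ofReal]
  · exact ((hc.mono fun τ hτ => mem_Ioi.2 (hs.trans_le hτ.1)).integrableOn_compact
      isCompact_Icc).mono_set Ioc_subset_Icc_self
  · exact Eventually.of_forall h0

theorem IsClassicalSolution.lintegral_gradNormSq {ν : ℝ} {u : ℝ → Plane → Plane}
    {p : ℝ → Plane → ℝ} (h : IsClassicalSolution ν u p) {t : ℝ} (ht : 0 < t) {A : Set Plane}
    (hAd : A ⊆ disk) :
    ∫⁻ x in A, ENNReal.ofReal (gradNormSq (u t) x)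
      = ENNReal.ofReal (∫ x in A, gradNormSq (u t) x) := by
  rw [ofReal_integral_eq_lintegral_ofReal ((h.integrableOn_gradNormSq ht).mono_set hAd)]
  exact Eventually.of_forall fun x => gradNormSq_nonneg _ _

/-- The energy balance bounds the dissipation by the loss of kinetic energy, and the inviscid flow
loses none. -/
theorem layerDissipation_le {ν : ℝ} (hν : 0 < ν) {w u : ℝ → Plane → Plane} {p q : ℝ → Plane → ℝ}
    (hw : IsClassicalSolution ν w p) (hw0 : ∀ t > 0, ∀ x ∈ circle, w t x = 0)
    (hlim : Tendsto (fun t => eLpNorm (w t - u 0) 2 (volume.restrict disk)) (𝓝[>] 0) (𝓝 0))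
    (hu : IsClassicalSolution 0 u q)
    (huc : ContinuousOn (fun z : ℝ × Plane => u z.1 z.2) (Ici 0 ×ˢ closedDisk)) {T : ℝ}
    (hT : 0 < T) (δ : ℝ) (hfin : distLinftyL2 T w u ≠ ⊤) :
    layerDissipation ν T δ w
      ≤ distLinftyL2 T w u * ENNReal.ofReal (√(∫ x in disk, ‖u 0 x‖ ^ 2)) := by
  set E := ∫ x in disk, ‖u 0 x‖ ^ 2 with hE
  have hE0 : 0 ≤ E := integral_nonneg fun x => sq_nonneg _
  set η := (distLinftyL2 T w u).toReal with hη
  have hη0 : 0 ≤ η := ENNReal.toReal_nonneg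
  have hu0c : ContinuousOn (u 0) closedDisk :=
    huc.comp (f := fun x : Plane => ((0 : ℝ), x)) (by fun_prop) fun x hx => ⟨mem_Ici.2 le_rfl, hx⟩
  have hwe : ∀ t > 0, ExtendsTo closedDisk disk (w t) := fun t ht =>
    .of_continuousOn (hw.contDiffOn_at ht).continuousOn
  have hue : ∀ t > 0, ExtendsTo closedDisk disk (u t) := fun t ht =>
    .of_continuousOn (hu.contDiffOn_at ht).continuousOn
  have hD0 : ∀ τ, 0 ≤ ∫ x in disk, gradNormSq (w τ) x := fun τ =>
    integral_nonneg fun x => gradNormSq_nonneg _ _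
  have hDc := hw.continuousOn_dissipation measurableSet_disk subset_rfl
  have hae : ∀ᵐ t ∂volume.restrict (Ioo 0 T), E - ∫ x in disk, ‖w t x‖ ^ 2 ≤ 2 * (η * √E) := by
    have hess : ∀ᵐ t ∂volume.restrict (Ioo 0 T),
        eLpNorm (w t - u t) 2 (volume.restrict disk) ≤ distLinftyL2 T w u := ae_le_essSup
    filter_upwards [hess, ae_restrict_mem measurableSet_Ioo] with t ht ht0
    have htri : eLpNorm (u t) 2 (volume.restrict disk)
        ≤ eLpNorm (w t) 2 (volume.restrict disk) + distLinftyL2 T w u := by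
      calc eLpNorm (u t) 2 (volume.restrict disk)
          = eLpNorm (w t - (w t - u t)) 2 (volume.restrict disk) := by rw [sub_sub_cancel]
        _ ≤ eLpNorm (w t) 2 (volume.restrict disk)
            + eLpNorm (w t - u t) 2 (volume.restrict disk) :=
          eLpNorm_sub_le (hwe t ht0.1).integrableOn.1
            ((hwe t ht0.1).sub (hue t ht0.1)).integrableOn.1 (by norm_num)
        _ ≤ _ := by gcongr
    rw [eLpNorm_two_eq (hwe t ht0.1), eLpNorm_two_eq (hue t ht0.1),
      hu.energy_eq_of_inviscid huc ht0.1, ← ENNReal.ofReal_toReal hfin,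
      ← ENNReal.ofReal_add (Real.sqrt_nonneg _) hη0,
      ENNReal.ofReal_le_ofReal_iff (by positivity)] at htri
    have hle := hw.energy_le hν.le hw0 hu0c hlim ht0.1
    set e := ∫ x in disk, ‖w t x‖ ^ 2 with he
    have he0 : 0 ≤ e := integral_nonneg fun x => sq_nonneg _
    have h1 : √e ≤ √E := Real.sqrt_le_sqrt hle
    nlinarith [Real.sq_sqrt hE0, Real.sq_sqrt he0, Real.sqrt_nonneg e, Real.sqrt_nonneg E]
  have hbound : ∀ s t, 0 < s → s ≤ t → t < T →
      ν * ∫ τ in s..t, ∫ x in disk, gradNormSq (w τ) x ≤ η * √E := by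
    intro s t hs hst htT
    -- The bound is available at some later time, because it holds almost everywhere.
    obtain ⟨r, hr, hrE⟩ : ∃ r ∈ Ioo t T, E - ∫ x in disk, ‖w r x‖ ^ 2 ≤ 2 * (η * √E) := by
      have hsub : Ioo t T ⊆ Ioo 0 T := Ioo_subset_Ioo_left (hs.le.trans hst)
      have h1 := ae_restrict_of_ae_restrict_of_subset hsub hae
      have h2 : (ae (volume.restrict (Ioo t T))).NeBot := by
        rw [ae_neBot, Ne, Measure.restrict_eq_zero, Real.volume_Ioo, ENNReal.ofReal_eq_zero]
        linarith
      obtain ⟨r, hr⟩ := (h1.and (ae_restrict_mem measurableSet_Ioo)).exists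
      exact ⟨r, hr.2, hr.1⟩
    have hsr : s ≤ r := hst.trans hr.1.le
    have h3 := hw.energy_sub_energy hw0 hs hsr
    have h4 := hw.energy_le hν.le hw0 hu0c hlim hs
    have h5 : ∫ τ in s..t, ∫ x in disk, gradNormSq (w τ) x
        ≤ ∫ τ in s..r, ∫ x in disk, gradNormSq (w τ) x := by
      refine intervalIntegral.integral_mono_interval le_rfl hst hr.1.le
        (Eventually.of_forall hD0) ?_
      refine (hDc.mono ?_).intervalIntegrable
      rw [uIcc_of_le hsr]
      exact fun τ hτ => mem_Ioi.2 (hs.trans_le hτ.1)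
    have h6 := mul_le_mul_of_nonneg_left h5 hν.le
    linarith
  have hlayer : ∫⁻ t in Ioo 0 T, ∫⁻ x in annulus δ, ENNReal.ofReal (gradNormSq (w t) x)
      ≤ ∫⁻ t in Ioo 0 T, ENNReal.ofReal (∫ x in disk, gradNormSq (w t) x) := by
    refine setLIntegral_mono' measurableSet_Ioo fun t ht => ?_
    rw [← hw.lintegral_gradNormSq ht.1 subset_rfl]
    exact lintegral_mono_set (annulus_subset_disk δ)
  have hmeas : AEMeasurable (fun t => ENNReal.ofReal (∫ x in disk, gradNormSq (w t) x))
      (volume.restrict (Ioo 0 T)) :=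
    ((hDc.mono fun τ hτ => mem_Ioi.2 hτ.1).aemeasurable measurableSet_Ioo).ennreal_ofReal
  have hfull := lintegral_Ioo_le_of_forall_Ioc hT hmeas (B := ENNReal.ofReal (η * √E / ν))
    fun s t hs hst htT => by
      rw [← ofReal_intervalIntegral hDc hD0 hs hst]
      refine ENNReal.ofReal_le_ofReal ?_
      rw [le_div_iff₀' hν]
      exact hbound s t hs hst htT
  calc layerDissipation ν T δ w ≤ ENNReal.ofReal ν * ENNReal.ofReal (η * √E / ν) := by
        rw [layerDissipation]
        gcongr
        exact hlayer.trans hfull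
    _ = ENNReal.ofReal (η * √E) := by
        rw [← ENNReal.ofReal_mul hν.le, mul_div_cancel₀ _ hν.ne']
    _ = distLinftyL2 T w u * ENNReal.ofReal (√E) := by
        rw [ENNReal.ofReal_mul hη0, ENNReal.ofReal_toReal hfin]

/-! ### The relative energy with corrector -/

/-- The relative energy `‖w‖² + ‖u‖² - 2 (w, u - v)` of the viscous flow `w` and the inviscid flow
`u`, in which the corrector `v` makes the test field `u - v` vanish on the circle. -/
def relativeEnergy (u v w : ℝ → Plane → Plane) (t : ℝ) : ℝ :=
  ((∫ x in disk, ‖w t x‖ ^ 2) + ∫ x in disk, ‖u t x‖ ^ 2)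
    - 2 * ∫ x in disk, inner ℝ (w t x) (u t x - v t x)

/-- The integrand of the time derivative of the relative energy. -/
def relativeEnergyRate (ν : ℝ) (u v w : ℝ → Plane → Plane) (t : ℝ) (x : Plane) : ℝ :=
  2 * (inner ℝ (w t x) (fderiv ℝ (v t) x (w t x))
    - inner ℝ (w t x - u t x) (fderiv ℝ (u t) x (w t x - u t x))
    + inner ℝ (w t x) (deriv (fun s => v s x) t)
    + ν * (gradInner (w t) (u t) x - gradInner (w t) (v t) x - gradNormSq (w t) x))

theorem divergence_sub {a b : Plane → Plane} {x : Plane} (ha : DifferentiableAt ℝ a x)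
    (hb : DifferentiableAt ℝ b x) :
    divergence (fun x => a x - b x) x = divergence a x - divergence b x := by
  simp only [divergence, partialDeriv, fderiv_fun_sub ha hb, sub_apply, PiLp.sub_apply,
    Finset.sum_sub_distrib]

section RelativeEnergy

variable {ν : ℝ} {u v w : ℝ → Plane → Plane} {p q : ℝ → Plane → ℝ}

theorem relativeEnergy_eq (hw : IsClassicalSolution ν w p) (hu : IsClassicalSolution 0 u q)
    (hv : ContDiffOn ℝ 1 (fun z : ℝ × Plane => v z.1 z.2) (Ioi 0 ×ˢ closedDisk)) {t : ℝ}
    (ht : 0 < t) :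
    relativeEnergy u v w t
      = (∫ x in disk, ‖w t x - u t x‖ ^ 2) + 2 * ∫ x in disk, inner ℝ (w t x) (v t x) := by
  have hwe : ExtendsTo closedDisk disk (w t) := .of_continuousOn (hw.contDiffOn_at ht).continuousOn
  have hue : ExtendsTo closedDisk disk (u t) := .of_continuousOn (hu.contDiffOn_at ht).continuousOn
  have hve : ExtendsTo closedDisk disk (v t) :=
    .of_continuousOn (contDiffOn_slice hv (mem_Ioi.2 ht)).continuousOn
  rw [relativeEnergy, ← integral_add hwe.norm_sq.integrableOn hue.norm_sq.integrableOn,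
    ← integral_const_mul, ← integral_sub (hwe.norm_sq.add hue.norm_sq).integrableOn
      ((hwe.inner (hue.sub hve)).integrableOn.const_mul 2), ← integral_const_mul,
    ← integral_add (hwe.sub hue).norm_sq.integrableOn ((hwe.inner hve).integrableOn.const_mul 2)]
  refine integral_congr_ae (Eventually.of_forall fun x => ?_)
  simp only [norm_sub_sq_real, inner_sub_right]
  ring

/-- The rate of the relative energy. Only the momentum equations tested with admissible fields
enter, so neither pressure appears. -/
theorem hasDerivAt_relativeEnergy (hw : IsClassicalSolution ν w p)
    (hw0 : ∀ t > 0, ∀ x ∈ circle, w t x = 0) (hu : IsClassicalSolution 0 u q)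
    (hv : ContDiffOn ℝ 1 (fun z : ℝ × Plane => v z.1 z.2) (Ioi 0 ×ˢ closedDisk))
    (hvdiv : ∀ t > 0, ∀ x ∈ disk, divergence (v t) x = 0)
    (hvu : ∀ t > 0, ∀ x ∈ circle, v t x = u t x) {t : ℝ} (ht : 0 < t) :
    HasDerivAt (relativeEnergy u v w) (∫ x in disk, relativeEnergyRate ν u v w t x) t := by
  have hut := hu.contDiffOn_at ht
  have hwt := hw.contDiffOn_at ht
  have hvt : ContDiffOn ℝ 1 (v t) closedDisk := contDiffOn_slice hv (mem_Ioi.2 ht)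
  have hwe : ExtendsTo closedDisk disk (w t) := .of_continuousOn hwt.continuousOn
  have hue : ExtendsTo closedDisk disk (u t) := .of_continuousOn hut.continuousOn
  have hwue := hwe.sub hue
  have hDu := extendsTo_fderiv hut
  have hDv := extendsTo_fderiv hvt
  have hut' := (extendsTo_timeDeriv (convex_Ioi 0) subset_rfl hu.contDiffOn_one).slice
    subset_rfl ht
  have hvt' := (extendsTo_timeDeriv (convex_Ioi 0) subset_rfl hv).slice subset_rfl ht
  have hudiv : ∀ x ∈ disk, divergence (u t) x = 0 := fun x hx => hu.divergence_eq_zero ht hx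
  have hwdiv : ∀ x ∈ disk, divergence (w t) x = 0 := fun x hx => hw.divergence_eq_zero ht hx
  have hubc := hu.tangential t ht
  have hwbc := hw.tangential t ht
  have d1 := hw.hasDerivAt_energy (.inr hw0) ht
  have d2 := hu.hasDerivAt_energy (.inl rfl) ht
  rw [mul_zero, zero_mul, neg_zero] at d2
  have d3 := hasDerivAt_integral_inner (g := fun t x => u t x - v t x) hw.contDiffOn_one
    (hu.contDiffOn_one.sub hv) ht
  have d4 := (d1.add d2).sub (d3.const_mul 2)
  refine d4.congr_deriv ?_
  -- The momentum equation of `w` is tested with `u - v`, which vanishes on the circle.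
  have m1 := hw.integral_inner_deriv ht (φ := fun x => u t x - v t x) (hut.sub hvt)
    (fun x hx => by
      rw [divergence_sub (differentiableAt_of_mem_disk hut hx)
        (differentiableAt_of_mem_disk hvt hx), hudiv x hx, hvdiv t ht x hx, sub_zero])
    (fun x hx => by simp [hvu t ht x hx]) (.inr fun x hx => by simp [hvu t ht x hx])
  -- The Euler equations are tested with `w`.
  have m2 := hu.integral_inner_deriv ht hwt hwdiv hwbc (.inl rfl)
  rw [zero_mul, sub_zero, ← neg_eq_iff_eq_neg.2 (integral_inner_convection hut hudiv hubc hut hwt)]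
    at m2
  have m3 := integral_inner_convection_self (w := fun x => w t x - u t x) (hwt.sub hut)
    (fun x hx => by
      rw [divergence_sub (differentiableAt_of_mem_disk hwt hx)
        (differentiableAt_of_mem_disk hut hx), hudiv x hx, hwdiv x hx, sub_zero])
    (fun x hx => by rw [inner_sub_left, hubc x hx, hwbc x hx, sub_zero]) hut
  have e1 : ExtendsTo closedDisk disk fun x => inner ℝ (w t x)
      (fderiv ℝ (fun x => u t x - v t x) x (w t x)) :=
    hwe.inner ((extendsTo_fderiv (hut.sub hvt)).clm_apply hwe)
  have e2 : ExtendsTo closedDisk disk (gradInner (w t) fun x => u t x - v t x) :=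
    extendsTo_gradInner hwt (hut.sub hvt)
  have e3 : ExtendsTo closedDisk disk (gradNormSq (w t)) := extendsTo_gradNormSq hwt
  have e4 : ExtendsTo closedDisk disk fun x => inner ℝ (w t x)
      (deriv (fun s => u s x - v s x) t) :=
    (hwe.inner (hut'.sub hvt')).congr fun x hx => by
      simp only
      rw [deriv_fun_sub (hasDerivAt_time subset_rfl hu.contDiffOn_one ht hx).differentiableAt
        (hasDerivAt_time subset_rfl hv ht hx).differentiableAt]
  have e5 : ExtendsTo closedDisk disk fun x => inner ℝ (deriv (fun s => u s x) t) (w t x) :=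
    hut'.inner hwe
  have e6 : ExtendsTo closedDisk disk fun x => inner ℝ (fderiv ℝ (u t) x (u t x)) (w t x) :=
    (hDu.clm_apply hue).inner hwe
  have e7 : ExtendsTo closedDisk disk fun x => inner ℝ (u t x)
      (fderiv ℝ (u t) x (w t x - u t x)) := hue.inner (hDu.clm_apply hwue)
  have key : ∀ x ∈ disk, relativeEnergyRate ν u v w t x
      = (-2 * inner ℝ (w t x) (fderiv ℝ (fun x => u t x - v t x) x (w t x))
        + 2 * ν * gradInner (w t) (fun x => u t x - v t x) x
        + -(2 * ν) * gradNormSq (w t) x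
        + -2 * inner ℝ (w t x) (deriv (fun s => u s x - v s x) t)
        + 2 * inner ℝ (deriv (fun s => u s x) t) (w t x)
        + 2 * inner ℝ (fderiv ℝ (u t) x (u t x)) (w t x)
        + 2 * inner ℝ (u t x) (fderiv ℝ (u t) x (w t x - u t x))) := by
    intro x hx
    have hux := differentiableAt_of_mem_disk hut hx
    have hvx := differentiableAt_of_mem_disk hvt hx
    rw [relativeEnergyRate,
      deriv_fun_sub (hasDerivAt_time subset_rfl hu.contDiffOn_one ht hx).differentiableAt
        (hasDerivAt_time subset_rfl hv ht hx).differentiableAt]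
    simp only [gradInner, partialDeriv, fderiv_fun_sub hux hvx, sub_apply, inner_sub_right,
      inner_sub_left, map_sub, Finset.sum_sub_distrib]
    rw [real_inner_comm (w t x) (deriv (fun s => u s x) t),
      real_inner_comm (w t x) (fderiv ℝ (u t) x (u t x))]
    ring
  have c := fun (a : ℝ) {f : Plane → ℝ} (hf : ExtendsTo closedDisk disk f) =>
    (ExtendsTo.const (K := closedDisk) (U := disk) a).mul hf
  have s1 := (c (-2) e1).add (c (2 * ν) e2)
  have s2 := s1.add (c (-(2 * ν)) e3)
  have s3 := s2.add (c (-2) e4)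
  have s4 := s3.add (c 2 e5)
  have s5 := s4.add (c 2 e6)
  rw [setIntegral_congr_fun measurableSet_disk key,
    integral_add s5.integrableOn (c 2 e7).integrableOn,
    integral_add s4.integrableOn (c 2 e6).integrableOn,
    integral_add s3.integrableOn (c 2 e5).integrableOn,
    integral_add s2.integrableOn (c (-2) e4).integrableOn,
    integral_add s1.integrableOn (c (-(2 * ν)) e3).integrableOn,
    integral_add (c (-2) e1).integrableOn (c (2 * ν) e2).integrableOn]
  simp only [integral_const_mul]
  rw [m3, m1, m2]
  ring

end RelativeEnergy

/-- Young's inequality. -/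
theorem abs_two_inner_le {H : Type*} [NormedAddCommGroup H] [InnerProductSpace ℝ H] (a b : H)
    {μ : ℝ} (hμ : 0 < μ) : |2 * inner ℝ a b| ≤ μ * ‖a‖ ^ 2 + μ⁻¹ * ‖b‖ ^ 2 := by
  have h1 := abs_real_inner_le_norm a b
  have h2 : 2 * (‖a‖ * ‖b‖) ≤ μ * ‖a‖ ^ 2 + μ⁻¹ * ‖b‖ ^ 2 := by
    have h3 : 0 ≤ μ⁻¹ * (μ * ‖a‖ - ‖b‖) ^ 2 := by positivity
    have h4 : μ⁻¹ * (μ * ‖a‖ - ‖b‖) ^ 2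
        = μ * ‖a‖ ^ 2 - 2 * (‖a‖ * ‖b‖) + μ⁻¹ * ‖b‖ ^ 2 := by
      field_simp
      ring
    linarith
  rw [abs_mul, abs_two]
  linarith

theorem abs_two_gradInner_le (a b : Plane → Plane) (x : Plane) {μ : ℝ} (hμ : 0 < μ) :
    |2 * gradInner a b x| ≤ μ * gradNormSq a x + μ⁻¹ * gradNormSq b x := by
  simp only [gradInner, gradNormSq, Finset.mul_sum, ← Finset.sum_add_distrib]
  exact (Finset.abs_sum_le_sum_abs _ _).trans
    (Finset.sum_le_sum fun i _ => abs_two_inner_le _ _ hμ)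

section Estimates

variable {ν δ K L : ℝ} {u v w : ℝ → Plane → Plane} {p q : ℝ → Plane → ℝ}

/-- The corrector is small in mean square, because it is bounded and its support is thin. -/
theorem abs_integral_inner_corrector_le (hw : IsClassicalSolution ν w p)
    (hv : ContDiffOn ℝ 1 (fun z : ℝ × Plane => v z.1 z.2) (Ioi 0 ×ˢ closedDisk))
    (hδ : 0 < δ) {t : ℝ} (ht : 0 < t) (hvK : ∀ x ∈ disk, ‖v t x‖ ≤ K)
    (hvl : ∀ x ∈ disk, x ∉ layer δ → v t x = 0) {μ : ℝ} (hμ : 0 < μ) :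
    |2 * ∫ x in disk, inner ℝ (w t x) (v t x)|
      ≤ μ * (∫ x in disk, ‖w t x‖ ^ 2) + Real.pi * μ⁻¹ * K ^ 2 * δ := by
  have hwe : ExtendsTo closedDisk disk (w t) := .of_continuousOn (hw.contDiffOn_at ht).continuousOn
  have hve : ExtendsTo closedDisk disk (v t) :=
    .of_continuousOn (contDiffOn_slice hv (mem_Ioi.2 ht)).continuousOn
  have i1 := (hwe.inner hve).integrableOn.const_mul 2
  have i2 := hwe.norm_sq.integrableOn.const_mul μ
  have i3 : IntegrableOn ((layer δ).indicator fun _ => μ⁻¹ * K ^ 2) disk :=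
    (integrable_const _).indicator (measurableSet_layer _)
  have hvol := volume_layer_le hδ.le
  rw [← integral_const_mul]
  calc |∫ x in disk, 2 * inner ℝ (w t x) (v t x)|
      ≤ ∫ x in disk, |2 * inner ℝ (w t x) (v t x)| := abs_integral_le_integral_abs
    _ ≤ ∫ x in disk, (μ * ‖w t x‖ ^ 2 + (layer δ).indicator (fun _ => μ⁻¹ * K ^ 2) x) := by
        refine setIntegral_mono_on i1.abs (i2.add i3) measurableSet_disk fun x hx => ?_
        by_cases hxl : x ∈ layer δ
        · rw [indicator_of_mem hxl]
          refine (abs_two_inner_le _ _ hμ).trans ?_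
          have := hvK x hx
          gcongr
        · rw [indicator_of_notMem hxl, hvl x hx hxl, inner_zero_right, mul_zero, abs_zero]
          positivity
    _ = μ * (∫ x in disk, ‖w t x‖ ^ 2) + volume.real (layer δ) * (μ⁻¹ * K ^ 2) := by
        rw [integral_add i2 i3, integral_const_mul, setIntegral_indicator (measurableSet_layer _),
          inter_eq_self_of_subset_right (layer_subset_disk _), setIntegral_const, smul_eq_mul]
    _ ≤ μ * (∫ x in disk, ‖w t x‖ ^ 2) + Real.pi * δ * (μ⁻¹ * K ^ 2) := by gcongr
    _ = _ := by ring

/-- Outside the layer the corrector contributes nothing to the rate of the relative energy; inside,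
its gradient costs a factor `1/δ`. -/
theorem relativeEnergyRate_le (hν : 0 < ν) {t : ℝ} {x : Plane}
    (hL : ‖fderiv ℝ (u t) x‖ ≤ L) (hK1 : ‖deriv (fun s => v s x) t‖ ≤ K)
    (hK2 : ‖fderiv ℝ (v t) x‖ ≤ K / δ)
    (hvl : x ∉ layer δ → deriv (fun s => v s x) t = 0 ∧ fderiv ℝ (v t) x = 0) {μ : ℝ}
    (hμ : 0 < μ) :
    relativeEnergyRate ν u v w t x
      ≤ 2 * L * ‖w t x - u t x‖ ^ 2 + μ * ‖w t x‖ ^ 2 + 2 * ν * L ^ 2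
        + (layer δ).indicator (fun x => (μ⁻¹ * K ^ 2 + 2 * ν * μ * K ^ 2 / δ ^ 2)
          + 2 * K / δ * ‖w t x‖ ^ 2 + ν * μ⁻¹ * gradNormSq (w t) x) x := by
  have e1 : -(2 * inner ℝ (w t x - u t x) (fderiv ℝ (u t) x (w t x - u t x)))
      ≤ 2 * L * ‖w t x - u t x‖ ^ 2 := by
    have h1 := (abs_le.1 (abs_real_inner_le_norm (w t x - u t x)
      (fderiv ℝ (u t) x (w t x - u t x)))).1
    have h2 := (fderiv ℝ (u t) x).le_of_opNorm_le hL (w t x - u t x)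
    have h3 := mul_le_mul_of_nonneg_left h2 (norm_nonneg (w t x - u t x))
    nlinarith
  have e2 : 2 * gradInner (w t) (u t) x ≤ gradNormSq (w t) x + 2 * L ^ 2 := by
    have h1 := (abs_le.1 (abs_two_gradInner_le (w t) (u t) x one_pos)).2
    have h2 := gradNormSq_le (u t) x
    have h3 : ‖fderiv ℝ (u t) x‖ ^ 2 ≤ L ^ 2 := by gcongr
    rw [inv_one, one_mul, one_mul] at h1
    linarith
  have e2' := mul_le_mul_of_nonneg_left e2 hν.le
  have hg := mul_nonneg hν.le (gradNormSq_nonneg (w t) x)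
  rw [relativeEnergyRate]
  by_cases hxl : x ∈ layer δ
  · rw [indicator_of_mem hxl]
    have e3 : 2 * inner ℝ (w t x) (deriv (fun s => v s x) t) ≤ μ * ‖w t x‖ ^ 2 + μ⁻¹ * K ^ 2 := by
      refine (abs_le.1 (abs_two_inner_le _ _ hμ)).2.trans ?_
      gcongr
    have e4 : 2 * inner ℝ (w t x) (fderiv ℝ (v t) x (w t x)) ≤ 2 * K / δ * ‖w t x‖ ^ 2 := by
      have h1 := real_inner_le_norm (w t x) (fderiv ℝ (v t) x (w t x))
      have h2 := (fderiv ℝ (v t) x).le_of_opNorm_le hK2 (w t x)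
      have h3 := mul_le_mul_of_nonneg_left h2 (norm_nonneg (w t x))
      calc 2 * inner ℝ (w t x) (fderiv ℝ (v t) x (w t x))
          ≤ 2 * (‖w t x‖ * (K / δ * ‖w t x‖)) := by linarith
        _ = _ := by ring
    have e5 : -(2 * gradInner (w t) (v t) x)
        ≤ μ⁻¹ * gradNormSq (w t) x + μ * (2 * (K / δ) ^ 2) := by
      have h1 := (abs_le.1 (abs_two_gradInner_le (w t) (v t) x (inv_pos.2 hμ))).1
      have h2 := gradNormSq_le (v t) x
      have h3 : ‖fderiv ℝ (v t) x‖ ^ 2 ≤ (K / δ) ^ 2 := by gcongr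
      have h4 : μ * gradNormSq (v t) x ≤ μ * (2 * (K / δ) ^ 2) := by gcongr; linarith
      rw [inv_inv] at h1
      linarith
    have e5' := mul_le_mul_of_nonneg_left e5 hν.le
    have h6 : ν * (μ * (2 * (K / δ) ^ 2)) = 2 * ν * μ * K ^ 2 / δ ^ 2 := by ring
    linarith
  · obtain ⟨h1, h2⟩ := hvl hxl
    have h3 : gradInner (w t) (v t) x = 0 := by simp [gradInner, partialDeriv, h2]
    rw [indicator_of_notMem hxl, h1, h2, h3]
    have h4 : 0 ≤ μ * ‖w t x‖ ^ 2 := by positivity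
    simp only [zero_apply, inner_zero_right]
    linarith

/-- The integrated rate. The convection term of the corrector, of size `1/δ`, is compensated by the
factor `δ²` of Poincaré's inequality in the layer. -/
theorem integral_relativeEnergyRate_le (hw : IsClassicalSolution ν w p)
    (hw0 : ∀ t > 0, ∀ x ∈ circle, w t x = 0) (hu : IsClassicalSolution 0 u q)
    (hv : ContDiffOn ℝ 1 (fun z : ℝ × Plane => v z.1 z.2) (Ioi 0 ×ˢ closedDisk))
    (hν : 0 < ν) (hδ : 0 < δ) (hδ1 : 2 * δ ≤ 1 / 2) (hK : 0 ≤ K) {t : ℝ} (ht : 0 < t)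
    (hL : ∀ x ∈ disk, ‖fderiv ℝ (u t) x‖ ≤ L)
    (hK1 : ∀ x ∈ disk, ‖deriv (fun s => v s x) t‖ ≤ K)
    (hK2 : ∀ x ∈ disk, ‖fderiv ℝ (v t) x‖ ≤ K / δ)
    (hvl : ∀ x ∈ disk, x ∉ layer δ → deriv (fun s => v s x) t = 0 ∧ fderiv ℝ (v t) x = 0)
    {μ : ℝ} (hμ : 0 < μ) :
    ∫ x in disk, relativeEnergyRate ν u v w t x
      ≤ 2 * L * (∫ x in disk, ‖w t x - u t x‖ ^ 2) + μ * (∫ x in disk, ‖w t x‖ ^ 2)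
        + Real.pi * (2 * ν * L ^ 2 + μ⁻¹ * K ^ 2 * δ + 2 * ν * μ * K ^ 2 / δ)
        + (16 * K * δ + ν * μ⁻¹) * ∫ x in annulus (2 * δ), gradNormSq (w t) x := by
  have hut := hu.contDiffOn_at ht
  have hwt := hw.contDiffOn_at ht
  have hvt : ContDiffOn ℝ 1 (v t) closedDisk := contDiffOn_slice hv (mem_Ioi.2 ht)
  have hwe : ExtendsTo closedDisk disk (w t) := .of_continuousOn hwt.continuousOn
  have hue : ExtendsTo closedDisk disk (u t) := .of_continuousOn hut.continuousOn
  have hvt' := (extendsTo_timeDeriv (convex_Ioi 0) subset_rfl hv).slice subset_rfl ht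
  have i0 : IntegrableOn (relativeEnergyRate ν u v w t) disk := by
    refine (ExtendsTo.mul (.const 2) (ExtendsTo.add (ExtendsTo.add (ExtendsTo.sub ?_ ?_) ?_)
      (ExtendsTo.mul (.const ν) (ExtendsTo.sub (ExtendsTo.sub ?_ ?_) ?_)))).integrableOn
    · exact hwe.inner ((extendsTo_fderiv hvt).clm_apply hwe)
    · exact (hwe.sub hue).inner ((extendsTo_fderiv hut).clm_apply (hwe.sub hue))
    · exact hwe.inner hvt'
    · exact extendsTo_gradInner hwt hut
    · exact extendsTo_gradInner hwt hvt
    · exact extendsTo_gradNormSq hwt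
  have i1 : IntegrableOn (fun x => 2 * L * ‖w t x - u t x‖ ^ 2) disk :=
    (hwe.sub hue).norm_sq.integrableOn.const_mul _
  have i2 : IntegrableOn (fun x => μ * ‖w t x‖ ^ 2) disk := hwe.norm_sq.integrableOn.const_mul _
  have i12 : IntegrableOn (fun x => 2 * L * ‖w t x - u t x‖ ^ 2 + μ * ‖w t x‖ ^ 2) disk :=
    i1.add i2
  have i3 : IntegrableOn (fun _ : Plane => 2 * ν * L ^ 2) disk := integrable_const _
  have i123 : IntegrableOn (fun x => 2 * L * ‖w t x - u t x‖ ^ 2 + μ * ‖w t x‖ ^ 2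
      + 2 * ν * L ^ 2) disk := i12.add i3
  have hgd : IntegrableOn (gradNormSq (w t)) disk := hw.integrableOn_gradNormSq ht
  have j1 : IntegrableOn (fun _ : Plane => μ⁻¹ * K ^ 2 + 2 * ν * μ * K ^ 2 / δ ^ 2) (layer δ) :=
    (integrable_const (μ := volume.restrict disk) _).mono_measure
      (Measure.restrict_mono_set _ (layer_subset_disk δ))
  have j2 : IntegrableOn (fun x => 2 * K / δ * ‖w t x‖ ^ 2) (layer δ) :=
    (hwe.norm_sq.integrableOn.mono_set (layer_subset_disk δ)).const_mul _
  have j12 : IntegrableOn (fun x => (μ⁻¹ * K ^ 2 + 2 * ν * μ * K ^ 2 / δ ^ 2)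
      + 2 * K / δ * ‖w t x‖ ^ 2) (layer δ) := j1.add j2
  have j3 : IntegrableOn (fun x => ν * μ⁻¹ * gradNormSq (w t) x) (layer δ) :=
    (hgd.mono_set (layer_subset_disk δ)).const_mul _
  have j123 : IntegrableOn (fun x => (μ⁻¹ * K ^ 2 + 2 * ν * μ * K ^ 2 / δ ^ 2)
      + 2 * K / δ * ‖w t x‖ ^ 2 + ν * μ⁻¹ * gradNormSq (w t) x) (layer δ) := j12.add j3
  have i4 : IntegrableOn ((layer δ).indicator fun x => (μ⁻¹ * K ^ 2 + 2 * ν * μ * K ^ 2 / δ ^ 2)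
      + 2 * K / δ * ‖w t x‖ ^ 2 + ν * μ⁻¹ * gradNormSq (w t) x) disk :=
    ((integrable_indicator_iff (measurableSet_layer δ)).2 j123).integrableOn
  have h1 := setIntegral_mono_on i0 (i123.add i4) measurableSet_disk fun x hx =>
    relativeEnergyRate_le (w := w) hν (hL x hx) (hK1 x hx) (hK2 x hx) (hvl x hx) hμ
  simp only [Pi.add_apply] at h1
  rw [integral_add i123 i4, integral_add i12 i3, integral_add i1 i2,
    setIntegral_indicator (measurableSet_layer _),
    inter_eq_self_of_subset_right (layer_subset_disk _), integral_add j12 j3, integral_add j1 j2,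
    setIntegral_const, setIntegral_const] at h1
  simp only [integral_const_mul, smul_eq_mul] at h1
  set Λ := ∫ x in annulus (2 * δ), gradNormSq (w t) x with hΛ
  have hsub : layer (2 * δ) ⊆ annulus (2 * δ) := layer_subset_annulus _
  have hmono : ∀ A : Set Plane, A ⊆ annulus (2 * δ) → ∫ x in A, gradNormSq (w t) x ≤ Λ :=
    fun A hA => setIntegral_mono_set (hgd.mono_set (annulus_subset_disk _))
      (Eventually.of_forall fun x => gradNormSq_nonneg _ _) hA.eventuallyLE
  have h2 : ∫ x in layer δ, ‖w t x‖ ^ 2 ≤ 8 * δ ^ 2 * Λ := by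
    refine (integral_layer_norm_sq_le hwt (hw0 t ht) hδ hδ1).trans ?_
    have := hmono _ hsub
    gcongr
  have h3 : ∫ x in layer δ, gradNormSq (w t) x ≤ Λ := by
    exact hmono _ (Subset.trans (fun x hx => ⟨hx.1, by linarith [hx.2]⟩ :
      layer δ ⊆ layer (2 * δ)) hsub)
  have h4 := volume_layer_le hδ.le
  have h5 : volume.real disk = Real.pi := by
    simp [disk, Measure.real, EuclideanSpace.volume_ball_fin_two, Real.pi_pos.le]
  have h6 : 2 * K / δ * ∫ x in layer δ, ‖w t x‖ ^ 2 ≤ 16 * K * δ * Λ := by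
    calc 2 * K / δ * ∫ x in layer δ, ‖w t x‖ ^ 2 ≤ 2 * K / δ * (8 * δ ^ 2 * Λ) := by gcongr
      _ = 16 * K * δ * Λ := by field_simp; ring
  have h7 : ν * μ⁻¹ * ∫ x in layer δ, gradNormSq (w t) x ≤ ν * μ⁻¹ * Λ := by gcongr
  have h8 : volume.real (layer δ) * (μ⁻¹ * K ^ 2 + 2 * ν * μ * K ^ 2 / δ ^ 2)
      ≤ Real.pi * (μ⁻¹ * K ^ 2 * δ + 2 * ν * μ * K ^ 2 / δ) := by
    calc volume.real (layer δ) * (μ⁻¹ * K ^ 2 + 2 * ν * μ * K ^ 2 / δ ^ 2)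
        ≤ Real.pi * δ * (μ⁻¹ * K ^ 2 + 2 * ν * μ * K ^ 2 / δ ^ 2) := by gcongr
      _ = _ := by field_simp
  rw [h5] at h1
  linarith

end Estimates

/-! ### Gronwall's inequality and the converse implication -/

/-- Gronwall's inequality on an open time interval, with an integrable forcing and an initial value
that is attained only in the limit. -/
theorem gronwall_Ioo {y y' g : ℝ → ℝ} {T M A B r : ℝ} (hM : 0 ≤ M) (hA : 0 ≤ A) (hr : 0 ≤ r)
    (hy : ∀ t ∈ Ioo 0 T, HasDerivAt y (y' t) t) (hg : ContinuousOn g (Ioi 0)) (hg0 : ∀ t, 0 ≤ g t)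
    (hle : ∀ t ∈ Ioo 0 T, y' t ≤ M * y t + A + g t)
    (hB : ∀ s t, 0 < s → s ≤ t → t < T → ∫ τ in s..t, g τ ≤ B)
    (hini : ∀ ε > 0, ∀ᶠ s in 𝓝[>] 0, y s ≤ r + ε) {t : ℝ} (ht : t ∈ Ioo 0 T) :
    y t ≤ Real.exp (M * T) * (r + A * T + B) := by
  set z : ℝ → ℝ := fun t => Real.exp (-(M * t)) * y t with hz
  have hzd : ∀ s ∈ Ioo 0 T, HasDerivAt z (Real.exp (-(M * s)) * (y' s - M * y s)) s := by
    intro s hs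
    have h1 : HasDerivAt (fun t => Real.exp (-(M * t))) (Real.exp (-(M * s)) * -(M * 1)) s :=
      (((hasDerivAt_id s).const_mul M).neg).exp
    exact (h1.mul (hy s hs)).congr_deriv (by ring)
  have hexp : ∀ s, 0 ≤ s → Real.exp (-(M * s)) ≤ 1 := fun s hs =>
    Real.exp_le_one_iff.2 (by have := mul_nonneg hM hs; linarith)
  have hB0 : 0 ≤ B := by simpa using hB t t ht.1 le_rfl ht.2
  have hT : 0 < T := ht.1.trans ht.2
  have hzt : z t ≤ r + A * T + B := by
    refine le_of_forall_pos_le_add fun ε hε => ?_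
    obtain ⟨s, hs, hst⟩ := ((hini ε hε).and (Ioc_mem_nhdsGT ht.1)).exists
    have hsub : Icc s t ⊆ Ioo 0 T := fun τ hτ => ⟨hst.1.trans_le hτ.1, hτ.2.trans_lt ht.2⟩
    have hgc : ContinuousOn (fun τ => A + g τ) (Icc s t) :=
      continuousOn_const.add (hg.mono fun τ hτ => mem_Ioi.2 (hsub hτ).1)
    have hgi : IntervalIntegrable g volume s t := by
      refine (hg.mono ?_).intervalIntegrable
      rw [uIcc_of_le hst.2]
      exact fun τ hτ => mem_Ioi.2 (hsub hτ).1
    have h1 := intervalIntegral.sub_le_integral_of_hasDeriv_right_of_le hst.2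
      (fun τ hτ => (hzd τ (hsub hτ)).continuousAt.continuousWithinAt)
      (fun τ hτ => (hzd τ (hsub (Ioo_subset_Icc_self hτ))).hasDerivWithinAt)
      (hgc.integrableOn_compact isCompact_Icc) fun τ hτ => by
        have hτ' := hsub (Ioo_subset_Icc_self hτ)
        have h2 : y' τ - M * y τ ≤ A + g τ := by linarith [hle τ hτ']
        calc Real.exp (-(M * τ)) * (y' τ - M * y τ) ≤ Real.exp (-(M * τ)) * (A + g τ) := by gcongr
          _ ≤ 1 * (A + g τ) :=
            mul_le_mul_of_nonneg_right (hexp τ hτ'.1.le) (add_nonneg hA (hg0 τ))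
          _ = A + g τ := one_mul _
    rw [intervalIntegral.integral_add intervalIntegrable_const hgi,
      intervalIntegral.integral_const, smul_eq_mul] at h1
    have h3 := hB s t hst.1 hst.2 ht.2
    have h4 : z s ≤ r + ε := by
      calc z s ≤ Real.exp (-(M * s)) * (r + ε) := by simp only [hz]; gcongr
        _ ≤ 1 * (r + ε) := by
          have := hexp s hst.1.le
          gcongr
        _ = r + ε := one_mul _
    have h5 : (t - s) * A ≤ A * T := by nlinarith [ht.2, hst.1]
    linarith
  have h6 : y t = Real.exp (M * t) * z t := by
    simp only [hz]
    rw [← mul_assoc, ← Real.exp_add, add_neg_cancel, Real.exp_zero, one_mul]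
  have h7 : 0 ≤ r + A * T + B := by positivity
  rw [h6]
  calc Real.exp (M * t) * z t ≤ Real.exp (M * t) * (r + A * T + B) := by gcongr
    _ ≤ Real.exp (M * T) * (r + A * T + B) := by
      have := ht.2.le
      gcongr

/-- Convergence to a common initial velocity in mean square. -/
theorem tendsto_integral_sub_sq {ν : ℝ} {w u : ℝ → Plane → Plane} {p : ℝ → Plane → ℝ}
    (hw : IsClassicalSolution ν w p)
    (hlim : Tendsto (fun t => eLpNorm (w t - u 0) 2 (volume.restrict disk)) (𝓝[>] 0) (𝓝 0))
    (huc : ContinuousOn (fun z : ℝ × Plane => u z.1 z.2) (Ici 0 ×ˢ closedDisk)) :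
    Tendsto (fun t => ∫ x in disk, ‖w t x - u t x‖ ^ 2) (𝓝[>] 0) (𝓝 0) := by
  have hus : ∀ t ≥ 0, ContinuousOn (u t) closedDisk := fun t ht =>
    huc.comp (f := fun x : Plane => (t, x)) (by fun_prop) fun x hx => ⟨mem_Ici.2 ht, hx⟩
  have hwe : ∀ t > 0, ExtendsTo closedDisk disk (w t) := fun t ht =>
    .of_continuousOn (hw.contDiffOn_at ht).continuousOn
  have hue : ∀ t ≥ 0, ExtendsTo closedDisk disk (u t) := fun t ht => .of_continuousOn (hus t ht)
  have l1 : Tendsto (fun t => ∫ x in disk, ‖w t x - u 0 x‖ ^ 2) (𝓝[>] 0) (𝓝 0) := by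
    have h1 := ((ENNReal.tendsto_toReal ENNReal.zero_ne_top).comp hlim).pow 2
    rw [ENNReal.toReal_zero, zero_pow two_ne_zero] at h1
    refine h1.congr' ?_
    filter_upwards [self_mem_nhdsWithin] with t ht
    have h2 : eLpNorm (w t - u 0) 2 (volume.restrict disk)
        = ENNReal.ofReal (√(∫ x in disk, ‖w t x - u 0 x‖ ^ 2)) :=
      eLpNorm_two_eq ((hwe t ht).sub (hue 0 le_rfl))
    rw [Function.comp_apply, h2, ENNReal.toReal_ofReal (Real.sqrt_nonneg _),
      Real.sq_sqrt (integral_nonneg fun x => sq_nonneg _)]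
  have l2 : Tendsto (fun t => ∫ x in disk, ‖u t x - u 0 x‖ ^ 2) (𝓝[>] 0) (𝓝 0) := by
    have hF : ContinuousOn (fun z : ℝ × Plane => ‖u z.1 z.2 - u 0 z.2‖ ^ 2)
        (Icc 0 1 ×ˢ closedDisk) := by
      refine ((huc.mono (prod_mono Icc_subset_Ici_self subset_rfl)).sub ?_).norm.pow 2
      exact (hus 0 le_rfl).comp continuousOn_snd fun z hz => hz.2
    have h1 := continuousOn_integral_Icc (F := fun z : ℝ × Plane => ‖u z.1 z.2 - u 0 z.2‖ ^ 2)
      (.of_continuousOn hF) measurableSet_disk subset_rfl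
    have h2 := (h1 0 (left_mem_Icc.2 zero_le_one)).tendsto
    simp only [sub_self, norm_zero, zero_pow two_ne_zero, integral_zero] at h2
    refine h2.mono_left ?_
    rw [← nhdsWithin_Ioc_eq_nhdsGT (zero_lt_one (α := ℝ))]
    exact nhdsWithin_mono _ Ioc_subset_Icc_self
  have l3 := (l1.const_mul 2).add (l2.const_mul 2)
  rw [mul_zero, add_zero] at l3
  refine tendsto_of_tendsto_of_tendsto_of_le_of_le' tendsto_const_nhds l3
    (Eventually.of_forall fun t => integral_nonneg fun x => sq_nonneg _) ?_
  filter_upwards [self_mem_nhdsWithin] with t ht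
  have ht0 : 0 < t := ht
  have i1 := ((hwe t ht).sub (hue 0 le_rfl)).norm_sq.integrableOn
  have i2 := ((hue t ht0.le).sub (hue 0 le_rfl)).norm_sq.integrableOn
  rw [← integral_const_mul, ← integral_const_mul,
    ← integral_add (i1.const_mul 2) (i2.const_mul 2)]
  refine integral_mono ((hwe t ht).sub (hue t ht0.le)).norm_sq.integrableOn
    ((i1.const_mul 2).fun_add (i2.const_mul 2)) fun x => ?_
  have h1 : w t x - u t x = (w t x - u 0 x) - (u t x - u 0 x) := by abel
  have h2 := norm_sub_le (w t x - u 0 x) (u t x - u 0 x)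
  rw [← h1] at h2
  nlinarith [norm_nonneg (w t x - u t x), sq_nonneg (‖w t x - u 0 x‖ - ‖u t x - u 0 x‖)]

/-- Kato's estimate for one value of the viscosity. The parameter `μ` comes from Young's inequality;
for `δ` proportional to `ν` the right-hand side becomes proportional to `μ` when `ν` and the layer
dissipation vanish. -/
theorem integral_sub_sq_le {ν δ K L T : ℝ} {u v w : ℝ → Plane → Plane} {p q : ℝ → Plane → ℝ}
    (hw : IsClassicalSolution ν w p) (hw0 : ∀ t > 0, ∀ x ∈ circle, w t x = 0)
    (hlim : Tendsto (fun t => eLpNorm (w t - u 0) 2 (volume.restrict disk)) (𝓝[>] 0) (𝓝 0))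
    (hu : IsClassicalSolution 0 u q)
    (huc : ContinuousOn (fun z : ℝ × Plane => u z.1 z.2) (Ici 0 ×ˢ closedDisk))
    (hv : ContDiffOn ℝ 1 (fun z : ℝ × Plane => v z.1 z.2) (Ioi 0 ×ˢ closedDisk))
    (hvdiv : ∀ t > 0, ∀ x ∈ disk, divergence (v t) x = 0)
    (hvu : ∀ t > 0, ∀ x ∈ circle, v t x = u t x)
    (hvl : ∀ t, ∀ x ∈ disk, x ∉ layer δ →
      v t x = 0 ∧ deriv (fun s => v s x) t = 0 ∧ fderiv ℝ (v t) x = 0)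
    (hvK : ∀ t ∈ Ioc 0 T, ∀ x ∈ disk,
      ‖v t x‖ ≤ K ∧ ‖deriv (fun s => v s x) t‖ ≤ K ∧ ‖fderiv ℝ (v t) x‖ ≤ K / δ)
    (hL : ∀ t ∈ Ioc 0 T, ∀ x ∈ disk, ‖fderiv ℝ (u t) x‖ ≤ L)
    (hν : 0 < ν) (hδ : 0 < δ) (hδ1 : 2 * δ ≤ 1 / 2) (hK : 0 ≤ K) (hL0 : 0 ≤ L)
    (hfin : layerDissipation ν T (2 * δ) w ≠ ⊤) {μ E : ℝ} (hμ : 0 < μ)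
    (hE : E = ∫ x in disk, ‖u 0 x‖ ^ 2) {t : ℝ} (ht : t ∈ Ioo 0 T) :
    ∫ x in disk, ‖w t x - u t x‖ ^ 2
      ≤ Real.exp (2 * L * T) * ((μ * E + Real.pi * μ⁻¹ * K ^ 2 * δ)
          + (2 * L * (μ * E + Real.pi * μ⁻¹ * K ^ 2 * δ) + (μ * E
            + Real.pi * (2 * ν * L ^ 2 + μ⁻¹ * K ^ 2 * δ + 2 * ν * μ * K ^ 2 / δ))) * T
          + (16 * K * δ / ν + μ⁻¹) * (layerDissipation ν T (2 * δ) w).toReal)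
        + (μ * E + Real.pi * μ⁻¹ * K ^ 2 * δ) := by
  set r := μ * E + Real.pi * μ⁻¹ * K ^ 2 * δ with hr
  have hE0 : 0 ≤ E := hE ▸ integral_nonneg fun x => sq_nonneg _
  have hr0 : 0 ≤ r := by have := Real.pi_pos; positivity
  have hu0c : ContinuousOn (u 0) closedDisk :=
    huc.comp (f := fun x : Plane => ((0 : ℝ), x)) (by fun_prop) fun x hx => ⟨mem_Ici.2 le_rfl, hx⟩
  have hen : ∀ s > 0, μ * ∫ x in disk, ‖w s x‖ ^ 2 ≤ μ * E := fun s hs => by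
    rw [hE]
    exact mul_le_mul_of_nonneg_left (hw.energy_le hν.le hw0 hu0c hlim hs) hμ.le
  have hcross : ∀ s ∈ Ioo 0 T, |relativeEnergy u v w s - ∫ x in disk, ‖w s x - u s x‖ ^ 2| ≤ r := by
    intro s hs
    have h1 := abs_integral_inner_corrector_le hw hv hδ hs.1
      (fun x hx => (hvK s ⟨hs.1, hs.2.le⟩ x hx).1) (fun x hx hxl => (hvl s x hx hxl).1) hμ
    rw [relativeEnergy_eq hw hu hv hs.1, add_sub_cancel_left]
    linarith [hen s hs.1]
  have hΛ0 : ∀ τ, 0 ≤ ∫ x in annulus (2 * δ), gradNormSq (w τ) x := fun τ =>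
    integral_nonneg fun x => gradNormSq_nonneg _ _
  have hΛc := hw.continuousOn_dissipation (measurableSet_annulus (2 * δ))
    (annulus_subset_disk (2 * δ))
  have hΛ : ∀ s t, 0 < s → s ≤ t → t < T →
      ν * ∫ τ in s..t, ∫ x in annulus (2 * δ), gradNormSq (w τ) x
        ≤ (layerDissipation ν T (2 * δ) w).toReal := by
    intro s t hs hst htT
    refine (ENNReal.ofReal_le_iff_le_toReal hfin).1 ?_
    rw [ENNReal.ofReal_mul hν.le, ofReal_intervalIntegral hΛc hΛ0 hs hst, layerDissipation]
    refine mul_le_mul_right ?_ _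
    calc ∫⁻ τ in Ioc s t, ENNReal.ofReal (∫ x in annulus (2 * δ), gradNormSq (w τ) x)
        = ∫⁻ τ in Ioc s t, ∫⁻ x in annulus (2 * δ), ENNReal.ofReal (gradNormSq (w τ) x) :=
          setLIntegral_congr_fun measurableSet_Ioc fun τ hτ =>
            (hw.lintegral_gradNormSq (hs.trans hτ.1) (annulus_subset_disk _)).symm
      _ ≤ ∫⁻ τ in Ioo 0 T, ∫⁻ x in annulus (2 * δ), ENNReal.ofReal (gradNormSq (w τ) x) :=
          lintegral_mono_set fun τ hτ => ⟨hs.trans hτ.1, hτ.2.trans_lt htT⟩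
  have hcoef : 0 ≤ 16 * K * δ + ν * μ⁻¹ := by positivity
  have hgr := gronwall_Ioo (y := relativeEnergy u v w) (M := 2 * L) (T := T) (r := r)
    (A := 2 * L * r + (μ * E
      + Real.pi * (2 * ν * L ^ 2 + μ⁻¹ * K ^ 2 * δ + 2 * ν * μ * K ^ 2 / δ)))
    (B := (16 * K * δ / ν + μ⁻¹) * (layerDissipation ν T (2 * δ) w).toReal)
    (g := fun τ => (16 * K * δ + ν * μ⁻¹) * ∫ x in annulus (2 * δ), gradNormSq (w τ) x)
    (by positivity) (by have := Real.pi_pos; positivity) hr0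
    (fun s hs => hasDerivAt_relativeEnergy hw hw0 hu hv hvdiv hvu hs.1)
    (continuousOn_const.mul hΛc) (fun τ => mul_nonneg hcoef (hΛ0 τ)) ?_ ?_ ?_ ht
  · have := (abs_le.1 (hcross t ht)).1
    linarith
  · intro s hs
    have hsT : s ∈ Ioc 0 T := ⟨hs.1, hs.2.le⟩
    have h1 := integral_relativeEnergyRate_le hw hw0 hu hv hν hδ hδ1 hK hs.1 (hL s hsT)
      (fun x hx => (hvK s hsT x hx).2.1) (fun x hx => (hvK s hsT x hx).2.2)
      (fun x hx hxl => (hvl s x hx hxl).2) hμ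
    have h2 := (abs_le.1 (hcross s hs)).1
    have h3 := mul_le_mul_of_nonneg_left (show ∫ x in disk, ‖w s x - u s x‖ ^ 2
      ≤ relativeEnergy u v w s + r by linarith) (show 0 ≤ 2 * L by positivity)
    linarith [hen s hs.1]
  · intro s t hs hst htT
    rw [intervalIntegral.integral_const_mul]
    calc (16 * K * δ + ν * μ⁻¹) * ∫ τ in s..t, ∫ x in annulus (2 * δ), gradNormSq (w τ) x
        = (16 * K * δ / ν + μ⁻¹)
          * (ν * ∫ τ in s..t, ∫ x in annulus (2 * δ), gradNormSq (w τ) x) := by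
          field_simp
      _ ≤ _ := mul_le_mul_of_nonneg_left (hΛ s t hs hst htT) (by positivity)
  · intro ε hε
    have hT : 0 < T := ht.1.trans ht.2
    filter_upwards [(tendsto_integral_sub_sq hw hlim huc).eventually (gt_mem_nhds hε),
      Ioo_mem_nhdsGT hT] with s hs hsT
    have := (abs_le.1 (hcross s hsT)).2
    linarith

theorem IsNavierStokesSolution.exists_isClassicalSolution {ν : ℝ} {u₀ : Plane → Plane}
    {w : ℝ → Plane → Plane} (h : IsNavierStokesSolution ν u₀ w) :
    ∃ p, IsClassicalSolution ν w p := by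
  obtain ⟨h1, ⟨p, hp, hs⟩, h0, -⟩ := h
  exact ⟨p, h1, hp, hs, fun t ht x hx => by rw [h0 t ht x hx, inner_zero_left]⟩

theorem IsEulerSolution.exists_isClassicalSolution {u₀ : Plane → Plane}
    {u : ℝ → Plane → Plane} (h : IsEulerSolution u₀ u) : ∃ q, IsClassicalSolution 0 u q := by
  obtain ⟨h1, ⟨q, hq, hs⟩, h0, -⟩ := h
  have hsub : Ioi (0 : ℝ) ×ˢ closedDisk ⊆ Ici 0 ×ˢ closedDisk :=
    prod_mono Ioi_subset_Ici_self subset_rfl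
  exact ⟨q, h1.mono hsub, hq.mono hsub, hs, fun t ht => h0 t (le_of_lt ht)⟩

/-- Vanishing dissipation in the layers of width `c ν` implies convergence. -/
theorem tendsto_distLinftyL2 {w : ℝ → ℝ → Plane → Plane} {u : ℝ → Plane → Plane}
    {u₀ : Plane → Plane} (hw : ∀ ν > 0, ∃ p, IsClassicalSolution ν (w ν) p)
    (hw0 : ∀ ν > 0, ∀ t > 0, ∀ x ∈ circle, w ν t x = 0)
    (hlim : ∀ ν > 0,
      Tendsto (fun t => eLpNorm (w ν t - u 0) 2 (volume.restrict disk)) (𝓝[>] 0) (𝓝 0))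
    (hu : IsEulerSolution u₀ u) {T c : ℝ} (hc : 0 < c)
    (hlayer : Tendsto (fun ν => layerDissipation ν T (c * ν) (w ν)) (𝓝[>] 0) (𝓝 0)) :
    Tendsto (fun ν => distLinftyL2 T (w ν) u) (𝓝[>] 0) (𝓝 0) := by
  obtain ⟨q, hq⟩ := hu.exists_isClassicalSolution
  have hus := hu.1
  obtain ⟨L, hL0, hL⟩ := (extendsTo_spaceDeriv (convex_Ici 0) Ioi_subset_Ici_self
    (hus.of_le (by exact_mod_cast le_top) : ContDiffOn ℝ 1 _ _)).exists_bound_Ioc T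
  obtain ⟨K, hK0, hcor⟩ := exists_corrector hus hq.tangential T
  set E := ∫ x in disk, ‖u 0 x‖ ^ 2 with hE
  have hE0 : 0 ≤ E := integral_nonneg fun x => sq_nonneg _
  have hreal : Tendsto (fun ν => (layerDissipation ν T (c * ν) (w ν)).toReal) (𝓝[>] 0) (𝓝 0) :=
    (ENNReal.tendsto_toReal ENNReal.zero_ne_top).comp hlayer
  rw [ENNReal.tendsto_nhds_zero]
  intro η hη
  obtain ⟨θ, hθ0, hθη⟩ := ENNReal.lt_iff_exists_nnreal_btwn.1 hη
  have hθ : 0 < (θ : ℝ) := by exact_mod_cast hθ0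
  -- `μ * Z` is what remains of the bound when the viscosity and the layer dissipation vanish.
  set Z := Real.exp (2 * L * T) * (E + (2 * L * E + (E + Real.pi * (4 * K ^ 2 / c))) * T) + E
    with hZ
  obtain ⟨μ, hμ, hμZ⟩ : ∃ μ > 0, μ * Z < (θ : ℝ) ^ 2 := by
    refine ⟨(θ : ℝ) ^ 2 / (|Z| + 1), by positivity, ?_⟩
    rw [div_mul_eq_mul_div, div_lt_iff₀ (by positivity)]
    have : (0 : ℝ) < (θ : ℝ) ^ 2 := by positivity
    nlinarith [le_abs_self Z]
  set Φ : ℝ × ℝ → ℝ := fun z =>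
    Real.exp (2 * L * T) * ((μ * E + Real.pi * μ⁻¹ * K ^ 2 * (c * z.1 / 2))
      + (2 * L * (μ * E + Real.pi * μ⁻¹ * K ^ 2 * (c * z.1 / 2)) + (μ * E
        + Real.pi * (2 * z.1 * L ^ 2 + μ⁻¹ * K ^ 2 * (c * z.1 / 2) + 4 * μ * K ^ 2 / c))) * T
      + (8 * K * c + μ⁻¹) * z.2)
    + (μ * E + Real.pi * μ⁻¹ * K ^ 2 * (c * z.1 / 2)) with hΦ
  have hΦc : Continuous Φ := by fun_prop
  have hΦ0 : Φ (0, 0) = μ * Z := by simp only [hΦ, hZ]; ring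
  have hΦlim : Tendsto (fun ν => Φ (ν, (layerDissipation ν T (c * ν) (w ν)).toReal)) (𝓝[>] 0)
      (𝓝 (μ * Z)) := by
    rw [← hΦ0]
    exact (hΦc.tendsto (0, 0)).comp
      (((tendsto_id : Tendsto id (𝓝 (0 : ℝ)) (𝓝 0)).mono_left nhdsWithin_le_nhds).prodMk_nhds
        hreal)
  filter_upwards [hΦlim.eventually (gt_mem_nhds hμZ), hlayer.eventually (gt_mem_nhds one_pos),
    Ioo_mem_nhdsGT (show 0 < 1 / (2 * c) by positivity)] with ν hν1 hν2 hν3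
  have hν : 0 < ν := hν3.1
  obtain ⟨p, hp⟩ := hw ν hν
  have hcν : c * ν ≤ 1 / 2 := by
    have h1 := hν3.2
    rw [lt_div_iff₀ (by positivity)] at h1
    linarith
  have hδ : 0 < c * ν / 2 := by positivity
  have h2δ : 2 * (c * ν / 2) = c * ν := by ring
  obtain ⟨v, hvs, hvdiv, hvu, hvl, hvK⟩ := hcor (c * ν / 2) hδ (by linarith)
  refine (essSup_le_of_ae_le (θ : ℝ≥0∞) ?_).trans hθη.le
  refine (ae_restrict_mem measurableSet_Ioo).mono fun t ht => ?_
  have hwu : eLpNorm (w ν t - u t) 2 (volume.restrict disk)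
      = ENNReal.ofReal (√(∫ x in disk, ‖w ν t x - u t x‖ ^ 2)) :=
    eLpNorm_two_eq (ExtendsTo.sub (.of_continuousOn (hp.contDiffOn_at ht.1).continuousOn)
      (.of_continuousOn (hq.contDiffOn_at ht.1).continuousOn))
  have hbound := integral_sub_sq_le hp (hw0 ν hν) (hlim ν hν) hq hus.continuousOn
    (hvs.mono (prod_mono Ioi_subset_Ici_self subset_rfl)) hvdiv hvu hvl hvK hL hν hδ
    (by linarith) hK0 hL0 (by rw [h2δ]; exact (hν2.trans ENNReal.one_lt_top).ne) hμ hE ht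
  have e1 : 16 * K * (c * ν / 2) / ν = 8 * K * c := by field_simp; ring
  have e2 : 2 * ν * μ * K ^ 2 / (c * ν / 2) = 4 * μ * K ^ 2 / c := by field_simp; ring
  rw [h2δ, e1, e2] at hbound
  have hlt : ∫ x in disk, ‖w ν t x - u t x‖ ^ 2 ≤ (θ : ℝ) ^ 2 := hbound.trans hν1.le
  change eLpNorm (w ν t - u t) 2 (volume.restrict disk) ≤ θ
  rw [hwu, ← ENNReal.ofReal_coe_nnreal]
  exact ENNReal.ofReal_le_ofReal (Real.sqrt_le_iff.2 ⟨hθ.le, hlt⟩)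

/-- Convergence implies vanishing dissipation, in layers of any width. -/
theorem tendsto_layerDissipation {w : ℝ → ℝ → Plane → Plane} {u : ℝ → Plane → Plane}
    {u₀ : Plane → Plane} (hw : ∀ ν > 0, ∃ p, IsClassicalSolution ν (w ν) p)
    (hw0 : ∀ ν > 0, ∀ t > 0, ∀ x ∈ circle, w ν t x = 0)
    (hlim : ∀ ν > 0,
      Tendsto (fun t => eLpNorm (w ν t - u 0) 2 (volume.restrict disk)) (𝓝[>] 0) (𝓝 0))
    (hu : IsEulerSolution u₀ u) {T : ℝ} (hT : 0 < T) (δ : ℝ → ℝ)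
    (hdist : Tendsto (fun ν => distLinftyL2 T (w ν) u) (𝓝[>] 0) (𝓝 0)) :
    Tendsto (fun ν => layerDissipation ν T (δ ν) (w ν)) (𝓝[>] 0) (𝓝 0) := by
  obtain ⟨q, hq⟩ := hu.exists_isClassicalSolution
  have h1 := ENNReal.Tendsto.mul_const (b := ENNReal.ofReal (√(∫ x in disk, ‖u 0 x‖ ^ 2))) hdist
    (.inr ENNReal.ofReal_ne_top)
  rw [zero_mul] at h1
  refine tendsto_of_tendsto_of_tendsto_of_le_of_le' tendsto_const_nhds h1
    (Eventually.of_forall fun _ => zero_le) ?_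
  filter_upwards [self_mem_nhdsWithin, hdist.eventually (gt_mem_nhds one_pos)] with ν hν hν1
  obtain ⟨p, hp⟩ := hw ν hν
  exact layerDissipation_le hν hp (hw0 ν hν) (hlim ν hν) hq hu.1.continuousOn hT (δ ν)
    (hν1.trans ENNReal.one_lt_top).ne

end KatoCriterion

end

theorem mainTheorem1
    (ω₀ : KatoCriterion.Plane → ℝ) (hω₀ : ContDiff ℝ ∞ ω₀) (hsupp : HasCompactSupport ω₀)
    (hdisk : tsupport ω₀ ⊆ KatoCriterion.disk)
    (uν : ℝ → ℝ → KatoCriterion.Plane → KatoCriterion.Plane)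
    (huν : ∀ ν > 0,
      KatoCriterion.IsNavierStokesSolution ν (KatoCriterion.biotSavart ω₀) (uν ν))
    (u : ℝ → KatoCriterion.Plane → KatoCriterion.Plane)
    (hu : KatoCriterion.IsEulerSolution (KatoCriterion.biotSavart ω₀) u)
    (T : ℝ) (hT : 0 < T) (c : ℝ) (hc : 0 < c) :
    Tendsto (fun ν => KatoCriterion.distLinftyL2 T (uν ν) u) (𝓝[>] 0) (𝓝 0) ↔
      Tendsto (fun ν => KatoCriterion.layerDissipation ν T (c * ν) (uν ν)) (𝓝[>] 0) (𝓝 0) := by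
  have hw := fun ν hν => (huν ν hν).exists_isClassicalSolution
  have hw0 := fun ν hν => (huν ν hν).2.2.1
  have hlim : ∀ ν > 0, Tendsto (fun t => eLpNorm (uν ν t - u 0) 2
      (volume.restrict KatoCriterion.disk)) (𝓝[>] 0) (𝓝 0) := by
    intro ν hν
    refine (huν ν hν).2.2.2.congr fun t => eLpNorm_congr_ae ?_
    filter_upwards [ae_restrict_mem KatoCriterion.measurableSet_disk] with x hx
    simp only [Pi.sub_apply, hu.2.2.2 x (KatoCriterion.disk_subset hx)]
  exact ⟨KatoCriterion.tendsto_layerDissipation hw hw0 hlim hu hT fun ν => c * ν,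
    KatoCriterion.tendsto_distLinftyL2 hw hw0 hlim hu hc⟩
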